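/- Let $s\in(1/2,1)$, $\sigma>0$, $\lambda_0^1>0$ and $$|\lambda_0^2|<c(\lambda_0^1):=2s\left(\frac{\lambda_0^1}{2s-1}\right)^{\frac{2s-1}{2s}} .$$ Put $$\widehat Q(\xi)=\begin{pmatrix}\lambda_0^1+|\xi|^{2s}&-i\lambda_0^2\xi\\ i\lambda_0^2\xi&\lambda_0^1+|\xi|^{2s}\end{pmatrix},\qquad \mathcal K(x)=(k_{ij}(x))_{i,j=1}^2=\frac1{2\pi}\int_{\mathbb R}e^{i\xi x}\,\widehat Q(\xi)^{-1}\,d\xi ,$$ (the $k_{ij}$ are real-valued), $G(v,w)=(g_1(v,w),g_2(v,w))=(v^2+w^2)^\sigma(v,w)$, and $$K_1=\frac{\sin(s\pi)}{\pi(\lambda_0^1)^2}\int_0^\infty z^{2s}e^{-z}\,dz .$$ Then $\lim_{|x|\to\infty}|x|^{2s+1}k_{11}(x)=K_1$. Moreover, let $v,w\in L^\infty(\mathbb R)$ be real-valued functions that tend to $0$ as $|x|\to\infty$ and satisfy the convolution system $(v,w)=\mathcal K*G(v,w)$, that is, for almost every $x\in\mathbb R$, $$v(x)=\int_{\mathbb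 R}\bigl(k_{11}(x-y)g_1(v(y),w(y))+k_{12}(x-y)g_2(v(y),w(y))\bigr)dy,$$ $$w(x)=\int_{\mathbb R}\bigl(k_{21}(x-y)g_1(v(y),w(y))+k_{22}(x-y)g_2(v(y),w(y))\bigr)dy.$$ Then $g_1(v,w),g_2(v,w)\in L^1(\mathbb R)$ and $$\lim_{|x|\to\infty}|x|^{2s+1}v(x)=K_1\int_{\mathbb R}g_1(v(y),w(y))\,dy,\qquad \lim_{|x|\to\infty}|x|^{2s+1}w(x)=K_1\int_{\mathbb R}g_2(v(y),w(y))\,dy .$$ In particular there is a constant $C$ with $|x|^{2s+1}(v(x)^2+w(x)^2)^{1/2}\le C$ for almost every $x$. Here the limits of $v$, $w$, $|x|^{2s+1}v$ and $|x|^{2s+1}w$ at infinity are essential limits (null sets are ignored); if the system holds at every $x\in\mathbb R$, then the last two are limits in the ordinary sense. -/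

import Mathlib

open Filter Topology MeasureTheory

noncomputable section

namespace FNLS

/-- The largest admissible speed `c(a) = 2s (a / (2s - 1)) ^ ((2s - 1) / (2s))`, `a = λ₀¹`. -/
def critSpeed (s a : ℝ) : ℝ :=
  2 * s * (a / (2 * s - 1)) ^ ((2 * s - 1) / (2 * s))

/-- The Fourier symbol of the linear operator `Q` of the profile equations
(`a = λ₀¹`, `b = λ₀²`; Fourier transform `f̂(ξ) = ∫ f(x) exp(-iξx) dx`). -/
def symbolQ (s a b ξ : ℝ) : Matrix (Fin 2) (Fin 2) ℂ :=
  !![((a + |ξ| ^ (2 * s) : ℝ) : ℂ), -Complex.I * b * ξ;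
     Complex.I * b * ξ, ((a + |ξ| ^ (2 * s) : ℝ) : ℂ)]

/-- The Fourier symbol of the matrix kernel `𝓚 = Q⁻¹`. -/
def symbolK (s a b ξ : ℝ) : Matrix (Fin 2) (Fin 2) ℂ :=
  (symbolQ s a b ξ)⁻¹

/-- `λ(ξ) = λ₊(ξ) λ₋(ξ)`, with `λ±(ξ) = |ξ| ^ (2s) + a ± b ξ`. -/
def lam (s a b ξ : ℝ) : ℝ :=
  (|ξ| ^ (2 * s) + a + b * ξ) * (|ξ| ^ (2 * s) + a - b * ξ)

/-- The entries of the symbol of the kernel. -/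
theorem symbolK_eq (s a b ξ : ℝ) :
    symbolK s a b ξ =
      !![((a + |ξ| ^ (2 * s) : ℝ) : ℂ) / lam s a b ξ, Complex.I * ξ * b / lam s a b ξ;
         -(Complex.I * ξ * b / lam s a b ξ), ((a + |ξ| ^ (2 * s) : ℝ) : ℂ) / lam s a b ξ] := by
  have hdet : (symbolQ s a b ξ).det = (lam s a b ξ : ℂ) := by
    rw [symbolQ, Matrix.det_fin_two_of, lam]
    push_cast
    linear_combination (-(b : ℂ) ^ 2 * (ξ : ℂ) ^ 2) * (-Complex.I_sq)
  rw [symbolK, Matrix.inv_def, hdet, Ring.inverse_eq_inv', symbolQ, Matrix.adjugate_fin_two_of]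
  ext i j
  fin_cases i <;> fin_cases j <;> simp [div_eq_mul_inv] <;> ring

/-- The inverse Fourier transform of the `(i, j)` entry of the symbol of `𝓚`. -/
def kernelC (s a b : ℝ) (i j : Fin 2) (x : ℝ) : ℂ :=
  (1 / (2 * Real.pi) : ℝ) *
    ∫ ξ : ℝ, Complex.exp (Complex.I * ξ * x) * symbolK s a b ξ i j

/-- The kernels are real-valued. -/
theorem kernelC_im (s a b : ℝ) (i j : Fin 2) (x : ℝ) : (kernelC s a b i j x).im = 0 := by
  rw [← Complex.conj_eq_iff_im, kernelC, map_mul, Complex.conj_ofReal, ← integral_conj]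
  congr 1
  rw [← integral_neg_eq_self]
  congr 1
  ext ξ
  have hl : lam s a b (-ξ) = lam s a b ξ := by simp [lam]; ring
  rw [symbolK_eq, symbolK_eq, hl]
  fin_cases i <;> fin_cases j <;>
    simp [← Complex.exp_conj]

/-- The kernel `k_{ij}` of the matrix kernel `𝓚`, as a real function. -/
def kernel (s a b : ℝ) (i j : Fin 2) (x : ℝ) : ℝ :=
  (kernelC s a b i j x).re

/-- The real kernel is the inverse Fourier transform of the symbol: no information is lost. -/
theorem ofReal_kernel (s a b : ℝ) (i j : Fin 2) (x : ℝ) :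
    (kernel s a b i j x : ℂ) = kernelC s a b i j x :=
  Complex.ext (by simp [kernel]) (by simp [kernelC_im])

/-- The nonlinearity `g₁(v, w) = (v² + w²) ^ σ v`. -/
def g₁ (σ v w : ℝ) : ℝ := (v ^ 2 + w ^ 2) ^ σ * v

/-- The nonlinearity `g₂(v, w) = (v² + w²) ^ σ w`. -/
def g₂ (σ v w : ℝ) : ℝ := (v ^ 2 + w ^ 2) ^ σ * w

/-- The convolution system `(v, w) = 𝓚 * G(v, w)` at the point `x`. -/
def SolvesAt (s a b σ : ℝ) (v w : ℝ → ℝ) (x : ℝ) : Prop :=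
  v x = ∫ y, (kernel s a b 0 0 (x - y) * g₁ σ (v y) (w y)
      + kernel s a b 0 1 (x - y) * g₂ σ (v y) (w y)) ∧
  w x = ∫ y, (kernel s a b 1 0 (x - y) * g₁ σ (v y) (w y)
      + kernel s a b 1 1 (x - y) * g₂ σ (v y) (w y))

/-- The constant `K₁ = sin(sπ) / (π a²) ∫₀^∞ z ^ (2s) exp(-z) dz`. -/
def K₁ (s a : ℝ) : ℝ :=
  Real.sin (s * Real.pi) / (Real.pi * a ^ 2)
    * ∫ z in Set.Ioi (0 : ℝ), z ^ (2 * s) * Real.exp (-z)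

/-- The filter of the essential limit `|x| → ∞`, in which null sets are ignored. -/
def essInfty : Filter ℝ := cocompact ℝ ⊓ ae volume

end FNLS

end

noncomputable section

namespace FNLS

/-! ### Lower bounds for the factors of the symbol -/

/-! Partial fractions split the symbol of `𝓚` over the two factors `|ξ|^(2s) + a ± bξ` of `lam`: a
diagonal entry is half the sum of their reciprocals, an off-diagonal one is, up to sign, `i` times
half the difference. By weighted AM-GM a subcritical speed keeps both factors above a multiple of `1
+ |ξ|^(2s)`, so the decay of the kernels is governed by the only non-smooth point, `ξ = 0`.

On each half-line three integrations by parts (`halfFourier_eq`) produce boundary terms of order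
`x⁻¹` and `x⁻²`, which cancel once the two half-lines and the two signs of `b` are combined, and a
remainder `x⁻³ ∫ (e^{iξx} - 1) rec'''(ξ) dξ`. Near `0`, `rec'''` is asymptotic to a multiple of
`ξ^(2s-3)` that does not depend on `b`. Rescaling `ξ = t/x` makes the integral asymptotic to
`x^(2-2s)` times a Mellin transform of `e^{it} - 1` (`tendsto_rpow_mul_halfFourier₃`). The imaginary
part of this constant is `π K₁` (`im_limitConst`) and gives the diagonal tail. The off-diagonal
kernel sees a difference of two integrals with the same limit, hence is `o(|x|^(-2s-1))`.

For the system, `G` is superlinear, so at infinity `|G|` is at most a small multiple of `|v| + |w|`.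
A contraction argument in weighted sup norms (`exists_le_weight_of_le_convolution`) then transfers
the decay of the kernel to the solution. Consequently `G` decays strictly faster than the kernel,
and the tail of the convolution is the tail of the kernel times the integral of `G`
(`tendsto_rpow_mul_convolution`). -/

theorem critSpeed_mul_le {s a r : ℝ} (hs : 1 / 2 < s) (ha : 0 < a) (hr : 0 ≤ r) :
    critSpeed s a * r ≤ a + r ^ (2 * s) := by
  have h1 : 0 < 2 * s - 1 := by linarith
  have h2 : 0 < 2 * s := by linarith
  -- The points are chosen so that the weighted arithmetic mean is `(a + r^(2s)) / (2s)` and the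
  -- geometric mean is `critSpeed s a * r / (2s)`.
  have h := Real.geom_mean_le_arith_mean2_weighted (w₁ := (2 * s - 1) / (2 * s)) (w₂ := 1 / (2 * s))
    (p₁ := a / (2 * s - 1)) (p₂ := r ^ (2 * s)) (by positivity) (by positivity) (by positivity)
    (by positivity) (by field_simp; ring)
  rw [← Real.rpow_mul hr, mul_one_div_cancel h2.ne', Real.rpow_one] at h
  calc critSpeed s a * r
      = 2 * s * ((a / (2 * s - 1)) ^ ((2 * s - 1) / (2 * s)) * r) := by rw [critSpeed]; ring
    _ ≤ 2 * s * ((2 * s - 1) / (2 * s) * (a / (2 * s - 1)) + 1 / (2 * s) * r ^ (2 * s)) := by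
        gcongr
    _ = a + r ^ (2 * s) := by field_simp

theorem critSpeed_pos {s a : ℝ} (hs : 1 / 2 < s) (ha : 0 < a) : 0 < critSpeed s a := by
  have h1 : 0 < 2 * s - 1 := by linarith
  rw [critSpeed]; positivity

/-- The linear term absorbs at most the fraction `|β| / critSpeed s a < 1` of `a + |ξ|^(2s)`; what
is left is coercive. -/
theorem exists_mul_le_factor {s a β : ℝ} (hs : 1 / 2 < s) (ha : 0 < a)
    (hβ : |β| < critSpeed s a) :
    ∃ c > 0, ∀ ξ : ℝ, c * (1 + |ξ| ^ (2 * s)) ≤ |ξ| ^ (2 * s) + a + β * ξ := by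
  have hc := critSpeed_pos hs ha
  have hθ : |β| / critSpeed s a < 1 := (div_lt_one hc).2 hβ
  refine ⟨(1 - |β| / critSpeed s a) * min a 1,
    mul_pos (by linarith) (lt_min ha one_pos), fun ξ => ?_⟩
  have h0 : 0 ≤ |ξ| ^ (2 * s) := by positivity
  have h1 : -(|β| / critSpeed s a * (a + |ξ| ^ (2 * s))) ≤ β * ξ := by
    have h2 : |β * ξ| ≤ |β| / critSpeed s a * (a + |ξ| ^ (2 * s)) := by
      calc |β * ξ| = |β| / critSpeed s a * (critSpeed s a * |ξ|) := by rw [abs_mul]; field_simp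
        _ ≤ _ := by gcongr; exact critSpeed_mul_le hs ha (abs_nonneg ξ)
    linarith [neg_abs_le (β * ξ)]
  have h3 : min a 1 * (1 + |ξ| ^ (2 * s)) ≤ a + |ξ| ^ (2 * s) := by
    nlinarith [min_le_left a 1, min_le_right a 1]
  nlinarith [mul_le_mul_of_nonneg_left h3 (by linarith : 0 ≤ 1 - |β| / critSpeed s a)]

/-! ### One factor of the symbol on the half-line and its derivatives -/

/-- The factor `a + β ξ + ξ ^ (2s)` of `lam` on the half-line `ξ ≥ 0`. -/
def fac (s a β ξ : ℝ) : ℝ := a + β * ξ + ξ ^ (2 * s)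

/-- The first derivative of `fac`. -/
def fac' (s β ξ : ℝ) : ℝ := β + 2 * s * ξ ^ (2 * s - 1)

/-- The second derivative of `fac`. -/
def fac'' (s ξ : ℝ) : ℝ := 2 * s * (2 * s - 1) * ξ ^ (2 * s - 2)

/-- The third derivative of `fac`. -/
def fac''' (s ξ : ℝ) : ℝ := 2 * s * (2 * s - 1) * (2 * s - 2) * ξ ^ (2 * s - 3)

/-- The reciprocal of `fac`. -/
def rec (s a β ξ : ℝ) : ℝ := 1 / fac s a β ξ

/-- The first derivative of `rec`. -/
def rec' (s a β ξ : ℝ) : ℝ := -(fac' s β ξ / fac s a β ξ ^ 2)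

/-- The second derivative of `rec`. -/
def rec'' (s a β ξ : ℝ) : ℝ :=
  -(fac'' s ξ / fac s a β ξ ^ 2) + 2 * fac' s β ξ ^ 2 / fac s a β ξ ^ 3

/-- The third derivative of `rec`. -/
def rec''' (s a β ξ : ℝ) : ℝ :=
  -(fac''' s ξ / fac s a β ξ ^ 2) + 6 * fac' s β ξ * fac'' s ξ / fac s a β ξ ^ 3
    - 6 * fac' s β ξ ^ 3 / fac s a β ξ ^ 4

section Derivatives

variable {s a β ξ : ℝ}

theorem hasDerivAt_fac (hξ : 0 < ξ) : HasDerivAt (fac s a β) (fac' s β ξ) ξ := by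
  have h := (((hasDerivAt_id ξ).const_mul β).const_add a).add
    (Real.hasDerivAt_rpow_const (p := 2 * s) (Or.inl hξ.ne'))
  simpa [fac', fac] using! h

theorem hasDerivAt_fac' (hξ : 0 < ξ) : HasDerivAt (fac' s β) (fac'' s ξ) ξ := by
  have h := ((Real.hasDerivAt_rpow_const (p := 2 * s - 1) (Or.inl hξ.ne')).const_mul
    (2 * s)).const_add β
  refine HasDerivAt.congr_deriv h ?_
  rw [fac'', show 2 * s - 1 - 1 = 2 * s - 2 by ring]; ring

theorem hasDerivAt_fac'' (hξ : 0 < ξ) : HasDerivAt (fac'' s) (fac''' s ξ) ξ := by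
  have h := (Real.hasDerivAt_rpow_const (p := 2 * s - 2) (Or.inl hξ.ne')).const_mul
    (2 * s * (2 * s - 1))
  refine HasDerivAt.congr_deriv h ?_
  rw [fac''', show 2 * s - 2 - 1 = 2 * s - 3 by ring]; ring

theorem hasDerivAt_rec (hξ : 0 < ξ) (hf : fac s a β ξ ≠ 0) :
    HasDerivAt (rec s a β) (rec' s a β ξ) ξ := by
  have h := (hasDerivAt_const ξ (1 : ℝ)).div (hasDerivAt_fac (s := s) (a := a) (β := β) hξ) hf
  refine HasDerivAt.congr_deriv h ?_
  rw [rec']; ring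

theorem hasDerivAt_rec' (hξ : 0 < ξ) (hf : fac s a β ξ ≠ 0) :
    HasDerivAt (rec' s a β) (rec'' s a β ξ) ξ := by
  have h := ((hasDerivAt_fac' (s := s) (β := β) hξ).div
    ((hasDerivAt_fac (s := s) (a := a) (β := β) hξ).pow 2) (pow_ne_zero 2 hf)).neg
  refine HasDerivAt.congr_deriv h ?_
  rw [rec'']; field_simp; simp; ring

theorem hasDerivAt_rec'' (hξ : 0 < ξ) (hf : fac s a β ξ ≠ 0) :
    HasDerivAt (rec'' s a β) (rec''' s a β ξ) ξ := by
  have hF := hasDerivAt_fac (s := s) (a := a) (β := β) hξ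
  have h := (((hasDerivAt_fac'' (s := s) hξ).div (hF.pow 2) (pow_ne_zero 2 hf)).neg).add
    ((((hasDerivAt_fac' (s := s) (β := β) hξ).pow 2).const_mul 2).div (hF.pow 3)
      (pow_ne_zero 3 hf))
  refine HasDerivAt.congr_deriv h ?_
  rw [rec''']; field_simp; simp; ring

end Derivatives

/-! ### Growth of the factor and of its derivatives -/

/-- The last two bounds let `fac'` and `ξ * fac'` be traded for `fac` in the derivatives of `rec`:
the first is the useful one near `0`, the second at infinity. -/
theorem exists_fac_bounds {s a β : ℝ} (hs : s ∈ Set.Ioo (1 / 2 : ℝ) 1) (ha : 0 < a)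
    (hβ : |β| < critSpeed s a) :
    ∃ c > 0, ∃ C > 0, ∀ ξ > 0, c ≤ fac s a β ξ ∧ c * ξ ≤ fac s a β ξ ∧
      |fac' s β ξ| ≤ C * fac s a β ξ ∧ ξ * |fac' s β ξ| ≤ C * fac s a β ξ := by
  obtain ⟨hs1, hs2⟩ := hs
  obtain ⟨c, hc, h⟩ := exists_mul_le_factor hs1 ha hβ
  have hC : 0 < (|β| + 2 * s) / c * 2 := by positivity
  refine ⟨c, hc, (|β| + 2 * s) / c * 2, hC, fun ξ hξ => ?_⟩
  have h1 : c * (1 + ξ ^ (2 * s)) ≤ fac s a β ξ := by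
    have := h ξ
    rw [abs_of_pos hξ] at this
    rw [fac]; linarith
  have hp : 0 < ξ ^ (2 * s) := by positivity
  have hle : ∀ q : ℝ, 0 ≤ q → q ≤ 2 * s → ξ ^ q ≤ 1 + ξ ^ (2 * s) := by
    intro q hq hq'
    rcases le_total ξ 1 with h1 | h1
    · linarith [Real.rpow_le_one hξ.le h1 hq]
    · linarith [Real.rpow_le_rpow_of_exponent_le h1 hq']
  have h2 : ξ ≤ 1 + ξ ^ (2 * s) := by simpa using hle 1 zero_le_one (by linarith)
  have h3 := hle (2 * s - 1) (by linarith) (by linarith)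
  have h4 : ξ * ξ ^ (2 * s - 1) = ξ ^ (2 * s) := by
    rw [Real.rpow_sub_one hξ.ne']; field_simp
  have h5 : |fac' s β ξ| ≤ |β| + 2 * s * ξ ^ (2 * s - 1) := by
    rw [fac']
    refine (abs_add_le _ _).trans_eq ?_
    rw [abs_of_nonneg (by positivity : 0 ≤ 2 * s * ξ ^ (2 * s - 1))]
  have hb := abs_nonneg β
  have h6 : (|β| + 2 * s) * 2 * (1 + ξ ^ (2 * s)) ≤ (|β| + 2 * s) / c * 2 * fac s a β ξ := by
    calc _ = (|β| + 2 * s) / c * 2 * (c * (1 + ξ ^ (2 * s))) := by field_simp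
      _ ≤ _ := by gcongr
  refine ⟨by nlinarith, by nlinarith, ?_, ?_⟩
  · refine h5.trans (le_trans ?_ h6)
    nlinarith
  · refine (mul_le_mul_of_nonneg_left h5 hξ.le).trans (le_trans ?_ h6)
    have : ξ * (|β| + 2 * s * ξ ^ (2 * s - 1)) = |β| * ξ + 2 * s * ξ ^ (2 * s) := by
      rw [← h4]; ring
    rw [this]
    nlinarith

theorem fac_pos {s a β ξ : ℝ} (hs : s ∈ Set.Ioo (1 / 2 : ℝ) 1) (ha : 0 < a)
    (hβ : |β| < critSpeed s a) (hξ : 0 < ξ) : 0 < fac s a β ξ := by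
  obtain ⟨c, hc, C, hC, h⟩ := exists_fac_bounds hs ha hβ
  linarith [(h ξ hξ).1]

/-- A single power is wanted on the whole half-line, although it is wasteful at infinity: being
homogeneous, it yields a dominating function independent of `x` after the rescaling `ξ = t/x`. -/
theorem exists_abs_rec'''_le {s a β : ℝ} (hs : s ∈ Set.Ioo (1 / 2 : ℝ) 1) (ha : 0 < a)
    (hβ : |β| < critSpeed s a) :
    ∃ C, ∀ ξ > 0, |rec''' s a β ξ| ≤ C * ξ ^ (2 * s - 3) := by
  obtain ⟨c, hc, C, hC, h⟩ := exists_fac_bounds hs ha hβ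
  obtain ⟨hs1, hs2⟩ := hs
  refine ⟨|2 * s * (2 * s - 1) * (2 * s - 2)| / c ^ 2 + 6 * C * |2 * s * (2 * s - 1)| / c ^ 2
    + 12 * C ^ 3 / c, fun ξ hξ => ?_⟩
  obtain ⟨h1, h2, h3, h4⟩ := h ξ hξ
  have hD : 0 < fac s a β ξ := hc.trans_le h1
  set D := fac s a β ξ with hDdef
  set E := |fac' s β ξ|
  have hE : 0 ≤ E := abs_nonneg _
  set w := ξ ^ (2 * s - 3) with hw
  have hw0 : 0 < w := by positivity
  have e2 : ξ ^ (2 * s - 2) = ξ * w := by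
    rw [hw, show 2 * s - 3 = 2 * s - 2 - 1 by ring, Real.rpow_sub_one hξ.ne']; field_simp
  -- The `fac' ^ 3` term carries no power of `ξ`. It is compared with `w` through this inequality,
  -- the factor `ξ ^ 3` being absorbed by the bound on `ξ * fac'`.
  have e3 : 1 ≤ (1 + ξ ^ 3) * w := by
    have : (1 : ℝ) = ξ ^ (3 - 2 * s) * w := by
      rw [hw, ← Real.rpow_add hξ]; simp
    rw [this]
    gcongr
    rcases le_total ξ 1 with h1 | h1
    · nlinarith [Real.rpow_le_one hξ.le h1 (by linarith : 0 ≤ 3 - 2 * s), pow_pos hξ 3]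
    · have := Real.rpow_le_rpow_of_exponent_le h1 (by push_cast; linarith : 3 - 2 * s ≤ (3 : ℕ))
      rw [Real.rpow_natCast] at this
      linarith
  have b1 : |fac''' s ξ / D ^ 2| ≤ |2 * s * (2 * s - 1) * (2 * s - 2)| / c ^ 2 * w := by
    rw [fac''', abs_div, abs_mul, abs_of_pos hw0, abs_of_pos (by positivity : 0 < D ^ 2),
      mul_div_right_comm]
    gcongr
  have b2 : |6 * fac' s β ξ * fac'' s ξ / D ^ 3| ≤
      6 * C * |2 * s * (2 * s - 1)| / c ^ 2 * w := by
    rw [abs_div, abs_mul, abs_mul, fac'', e2, abs_mul _ (ξ * w), abs_of_pos (by positivity : 0 < D ^ 3),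
      abs_of_pos (by positivity : 0 < ξ * w), abs_of_pos (by norm_num : (0 : ℝ) < 6)]
    calc 6 * E * (|2 * s * (2 * s - 1)| * (ξ * w)) / D ^ 3
        = 6 * (ξ * E) * |2 * s * (2 * s - 1)| * w / D ^ 3 := by ring
      _ ≤ 6 * (C * D) * |2 * s * (2 * s - 1)| * w / D ^ 3 := by gcongr
      _ = 6 * C * |2 * s * (2 * s - 1)| / D ^ 2 * w := by field_simp
      _ ≤ _ := by gcongr
  have b3 : |6 * fac' s β ξ ^ 3 / D ^ 4| ≤ 12 * C ^ 3 / c * w := by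
    rw [abs_div, abs_mul, abs_pow, abs_of_pos (by positivity : 0 < D ^ 4),
      abs_of_pos (by norm_num : (0 : ℝ) < 6)]
    calc 6 * E ^ 3 / D ^ 4 ≤ 6 * (E ^ 3 * ((1 + ξ ^ 3) * w)) / D ^ 4 := by
          gcongr
          exact le_mul_of_one_le_right (by positivity) e3
      _ = 6 * ((E ^ 3 + (ξ * E) ^ 3) * w) / D ^ 4 := by ring
      _ ≤ 6 * (((C * D) ^ 3 + (C * D) ^ 3) * w) / D ^ 4 := by gcongr
      _ = 12 * C ^ 3 / D * w := by field_simp; ring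
      _ ≤ _ := by gcongr
  rw [rec''']
  calc _ ≤ |fac''' s ξ / D ^ 2| + |6 * fac' s β ξ * fac'' s ξ / D ^ 3|
        + |6 * fac' s β ξ ^ 3 / D ^ 4| := by
        refine (abs_sub _ _).trans (add_le_add_left ((abs_add_le _ _).trans ?_) _)
        rw [abs_neg]
    _ ≤ _ := by linarith [b1, b2, b3]

/-! ### Limits at the origin and at infinity -/

section Limits

variable {s a β : ℝ}

theorem tendsto_rpow_nhdsGT_zero {q : ℝ} (hq : 0 < q) :
    Tendsto (fun ξ : ℝ => ξ ^ q) (𝓝[>] 0) (𝓝 0) := by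
  have h := (Real.continuousAt_rpow_const 0 q (Or.inr hq.le)).tendsto
  rw [Real.zero_rpow hq.ne'] at h
  exact h.mono_left nhdsWithin_le_nhds

theorem tendsto_fac_zero (hs : s ∈ Set.Ioo (1 / 2 : ℝ) 1) :
    Tendsto (fac s a β) (𝓝[>] 0) (𝓝 a) := by
  have h1 : Tendsto (fun ξ : ℝ => ξ) (𝓝[>] 0) (𝓝 0) := tendsto_id.mono_left nhdsWithin_le_nhds
  have h := ((h1.const_mul β).const_add a).add
    (tendsto_rpow_nhdsGT_zero (q := 2 * s) (by linarith [hs.1]))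
  simpa [fac] using! h

theorem tendsto_fac'_zero (hs : s ∈ Set.Ioo (1 / 2 : ℝ) 1) :
    Tendsto (fac' s β) (𝓝[>] 0) (𝓝 β) := by
  have h := ((tendsto_rpow_nhdsGT_zero (q := 2 * s - 1) (by linarith [hs.1])).const_mul
    (2 * s)).const_add β
  simpa [fac'] using! h

theorem tendsto_rec_zero (hs : s ∈ Set.Ioo (1 / 2 : ℝ) 1) (ha : 0 < a) :
    Tendsto (rec s a β) (𝓝[>] 0) (𝓝 (1 / a)) :=
  tendsto_const_nhds.div (tendsto_fac_zero hs) ha.ne'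

theorem tendsto_rec'_zero (hs : s ∈ Set.Ioo (1 / 2 : ℝ) 1) (ha : 0 < a) :
    Tendsto (rec' s a β) (𝓝[>] 0) (𝓝 (-(β / a ^ 2))) :=
  ((tendsto_fac'_zero hs).div ((tendsto_fac_zero hs).pow 2) (by positivity)).neg

/-- `rec''` can blow up like `ξ^(2s-2)` at the origin; the factor `ξ` stands for the first-order
vanishing of `e^{iξx} - 1` in the boundary term. -/
theorem tendsto_mul_rec''_zero (hs : s ∈ Set.Ioo (1 / 2 : ℝ) 1) (ha : 0 < a) :
    Tendsto (fun ξ => ξ * rec'' s a β ξ) (𝓝[>] 0) (𝓝 0) := by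
  have h1 : Tendsto (fun ξ : ℝ => ξ) (𝓝[>] 0) (𝓝 0) := tendsto_id.mono_left nhdsWithin_le_nhds
  have hF := tendsto_fac_zero (a := a) (β := β) hs
  have h2 := (((tendsto_rpow_nhdsGT_zero (q := 2 * s - 1) (by linarith [hs.1])).const_mul
    (2 * s * (2 * s - 1))).div (hF.pow 2) (by positivity)).neg
  have h3 := h1.mul (((((tendsto_fac'_zero (β := β) hs).pow 2).const_mul 2)).div (hF.pow 3)
    (by positivity))
  have h := h2.add h3
  simp only [mul_zero, zero_div, neg_zero, zero_mul, add_zero] at h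
  refine h.congr' ?_
  filter_upwards [self_mem_nhdsWithin] with ξ hξ
  have hξ' : (0 : ℝ) < ξ := hξ
  have : ξ ^ (2 * s - 1) = ξ * ξ ^ (2 * s - 2) := by
    rw [show 2 * s - 2 = 2 * s - 1 - 1 by ring, Real.rpow_sub_one hξ'.ne' (2 * s - 1)]; field_simp
  simp only [rec'', fac'', Pi.div_apply]
  rw [this]
  ring

/-- Only the `fac'''` term is as singular as `ξ^(2s-3)`. The limit is free of `β`, which is why `K₁`
does not depend on `b` and why the off-diagonal tail vanishes. -/
theorem tendsto_rpow_mul_rec'''_zero (hs : s ∈ Set.Ioo (1 / 2 : ℝ) 1) (ha : 0 < a) :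
    Tendsto (fun ξ => ξ ^ (3 - 2 * s) * rec''' s a β ξ) (𝓝[>] 0)
      (𝓝 (-(2 * s * (2 * s - 1) * (2 * s - 2) / a ^ 2))) := by
  have h1 : Tendsto (fun ξ : ℝ => ξ) (𝓝[>] 0) (𝓝 0) := tendsto_id.mono_left nhdsWithin_le_nhds
  have hF := tendsto_fac_zero (a := a) (β := β) hs
  have hF' := tendsto_fac'_zero (β := β) hs
  have t1 := ((tendsto_const_nhds (x := 2 * s * (2 * s - 1) * (2 * s - 2)) (f := 𝓝[>] (0 : ℝ))).div
    (hF.pow 2) (by positivity)).neg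
  have t2 := ((hF'.const_mul 6).mul (h1.const_mul (2 * s * (2 * s - 1)))).div (hF.pow 3)
    (by positivity)
  have t3 := (((hF'.pow 3).const_mul 6).mul (tendsto_rpow_nhdsGT_zero (q := 3 - 2 * s)
    (by linarith [hs.2]))).div (hF.pow 4) (by positivity)
  have h := (t1.add t2).sub t3
  simp only [mul_zero, zero_div, add_zero, sub_zero] at h
  refine h.congr' ?_
  filter_upwards [self_mem_nhdsWithin] with ξ hξ
  have hξ' : (0 : ℝ) < ξ := hξ
  have e1 : ξ ^ (3 - 2 * s) * ξ ^ (2 * s - 3) = 1 := by rw [← Real.rpow_add hξ']; simp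
  have e2 : ξ ^ (3 - 2 * s) * ξ ^ (2 * s - 2) = ξ := by
    rw [← Real.rpow_add hξ', show 3 - 2 * s + (2 * s - 2) = 1 by ring, Real.rpow_one]
  simp only [rec''', fac'', fac''', Pi.div_apply]
  linear_combination (2 * s * (2 * s - 1) * (2 * s - 2) / fac s a β ξ ^ 2) * e1
    - (6 * fac' s β ξ * (2 * s * (2 * s - 1)) / fac s a β ξ ^ 3) * e2

theorem tendsto_rec_atTop (hs : s ∈ Set.Ioo (1 / 2 : ℝ) 1) (ha : 0 < a)
    (hβ : |β| < critSpeed s a) : Tendsto (rec s a β) atTop (𝓝 0) := by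
  obtain ⟨c, hc, C, hC, h⟩ := exists_fac_bounds hs ha hβ
  have h1 : Tendsto (fac s a β) atTop atTop :=
    tendsto_atTop_mono' _ ((eventually_gt_atTop 0).mono fun ξ hξ => (h ξ hξ).2.1)
      (tendsto_id.const_mul_atTop hc)
  exact h1.inv_tendsto_atTop.congr fun ξ => (one_div _).symm

theorem tendsto_rec'_atTop (hs : s ∈ Set.Ioo (1 / 2 : ℝ) 1) (ha : 0 < a)
    (hβ : |β| < critSpeed s a) : Tendsto (rec' s a β) atTop (𝓝 0) := by
  obtain ⟨c, hc, C, hC, h⟩ := exists_fac_bounds hs ha hβ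
  have h1 := (tendsto_rec_atTop hs ha hβ).const_mul C
  rw [mul_zero] at h1
  refine squeeze_zero_norm' ?_ h1
  filter_upwards [eventually_gt_atTop 0] with ξ hξ
  obtain ⟨h1, h2, h3, h4⟩ := h ξ hξ
  have hD : 0 < fac s a β ξ := hc.trans_le h1
  rw [rec', rec, norm_neg, Real.norm_eq_abs, abs_div, abs_of_pos (by positivity : 0 < fac s a β ξ ^ 2),
    div_le_iff₀ (by positivity)]
  refine h3.trans_eq ?_
  field_simp

theorem tendsto_rec''_atTop (hs : s ∈ Set.Ioo (1 / 2 : ℝ) 1) (ha : 0 < a)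
    (hβ : |β| < critSpeed s a) : Tendsto (rec'' s a β) atTop (𝓝 0) := by
  obtain ⟨c, hc, C, hC, h⟩ := exists_fac_bounds hs ha hβ
  have hr := tendsto_rec_atTop hs ha hβ
  have hp : Tendsto (fun ξ : ℝ => ξ ^ (2 * s - 2)) atTop (𝓝 0) := by
    have := tendsto_rpow_neg_atTop (y := 2 - 2 * s) (by linarith [hs.2])
    simpa using this
  have t1 := ((hp.const_mul (2 * s * (2 * s - 1))).mul (hr.pow 2)).neg
  have t2 : Tendsto (fun ξ => 2 * fac' s β ξ ^ 2 / fac s a β ξ ^ 3) atTop (𝓝 0) := by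
    have h1 := hr.const_mul (2 * C ^ 2)
    rw [mul_zero] at h1
    refine squeeze_zero_norm' ?_ h1
    filter_upwards [eventually_gt_atTop 0] with ξ hξ
    obtain ⟨h1, h2, h3, h4⟩ := h ξ hξ
    have hD : 0 < fac s a β ξ := hc.trans_le h1
    rw [rec, Real.norm_eq_abs, abs_div, abs_of_pos (by positivity : 0 < fac s a β ξ ^ 3),
      abs_mul, abs_pow, abs_of_pos (by norm_num : (0 : ℝ) < 2), div_le_iff₀ (by positivity)]
    calc 2 * |fac' s β ξ| ^ 2 ≤ 2 * (C * fac s a β ξ) ^ 2 := by gcongr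
      _ = _ := by field_simp
  have h := t1.add t2
  simp only [mul_zero, zero_mul, neg_zero, add_zero] at h
  refine h.congr fun ξ => ?_
  simp [rec'', rec, fac'', div_eq_mul_inv]

end Limits

/-! ### The Mellin transform of `exp (I t) - 1` -/

theorem norm_exp_I_mul_sub_one_le_min {t : ℝ} (ht : 0 ≤ t) :
    ‖Complex.exp (Complex.I * t) - 1‖ ≤ min t 2 := by
  refine le_min ?_ ?_
  · simpa [abs_of_nonneg ht] using Real.norm_exp_I_mul_ofReal_sub_one_le (x := t)
  · refine (norm_sub_le _ _).trans_eq ?_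
    rw [Complex.norm_exp_I_mul_ofReal, norm_one]; norm_num

/-- The function `min t 2` dominates `|e^{it} - 1|`, so the integrand is at most `t^q` near `0`
(integrable as `q > -1`) and `2 t^(q-1)` at infinity (integrable as `q < 0`). -/
theorem integrableOn_min_mul_rpow {q : ℝ} (hq : q ∈ Set.Ioo (-1 : ℝ) 0) :
    IntegrableOn (fun t : ℝ => min t 2 * t ^ (q - 1)) (Set.Ioi 0) := by
  have hm : ∀ S : Set ℝ, AEStronglyMeasurable (fun t : ℝ => min t 2 * t ^ (q - 1))
      (volume.restrict S) := fun S => (by fun_prop : Measurable _).aestronglyMeasurable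
  rw [← Set.Ioc_union_Ioi_eq_Ioi zero_le_one]
  refine IntegrableOn.union ?_ ?_
  · have h := (intervalIntegral.intervalIntegrable_rpow' (a := 0) (b := 1) hq.1)
    rw [intervalIntegrable_iff_integrableOn_Ioc_of_le zero_le_one] at h
    refine Integrable.mono' h (hm _) ?_
    filter_upwards [ae_restrict_mem measurableSet_Ioc] with t ht
    have h0 : 0 < t := ht.1
    rw [Real.norm_eq_abs, abs_of_nonneg (by positivity), Real.rpow_sub_one h0.ne']
    calc min t 2 * (t ^ q / t) ≤ t * (t ^ q / t) := by gcongr; exact min_le_left _ _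
      _ = t ^ q := by field_simp
  · have h := (integrableOn_Ioi_rpow_of_lt (a := q - 1) (by linarith [hq.2]) one_pos).const_mul 2
    refine Integrable.mono' h (hm _) ?_
    filter_upwards [ae_restrict_mem measurableSet_Ioi] with t ht
    have h0 : 0 < t := one_pos.trans ht
    rw [Real.norm_eq_abs, abs_of_nonneg (by positivity)]
    gcongr
    exact min_le_right _ _

theorem integrableOn_rpow_mul_cexp {q : ℝ} (hq : -1 < q) {r : ℂ} (hr : 0 < r.re) :
    IntegrableOn (fun t : ℝ => ((t ^ q : ℝ) : ℂ) * Complex.exp (-r * t)) (Set.Ioi 0) := by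
  have h := integrableOn_rpow_mul_exp_neg_mul_rpow hq one_pos hr
  refine Integrable.mono' h ?_ ?_
  · exact (by fun_prop : Measurable _).aestronglyMeasurable
  · filter_upwards [ae_restrict_mem measurableSet_Ioi] with t ht
    have h0 : (0 : ℝ) < t := ht
    rw [norm_mul, Complex.norm_exp, Complex.norm_real, Real.norm_eq_abs,
      abs_of_nonneg (by positivity)]
    simp

theorem differentiableAt_integral_rpow_mul_cexp {q : ℝ} (hq : -1 < q) {r : ℂ} (hr : 0 < r.re) :
    DifferentiableAt ℂ
      (fun z : ℂ => ∫ t in Set.Ioi (0 : ℝ), ((t ^ q : ℝ) : ℂ) * Complex.exp (-z * t)) r := by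
  -- Halving the real part gives a neighbourhood on which the differentiated integrand has one
  -- integrable majorant.
  have hU : {z : ℂ | r.re / 2 < z.re} ∈ 𝓝 r :=
    (isOpen_lt continuous_const Complex.continuous_re).mem_nhds (by simp; linarith)
  refine (hasDerivAt_integral_of_dominated_loc_of_deriv_le
    (F := fun (z : ℂ) (t : ℝ) => ((t ^ q : ℝ) : ℂ) * Complex.exp (-z * t))
    (μ := volume.restrict (Set.Ioi 0))
    (F' := fun z t => ((t ^ q : ℝ) : ℂ) * (Complex.exp (-z * t) * (-1 * t)))
    (bound := fun t => t ^ (q + 1) * Real.exp (-(r.re / 2) * t ^ (1 : ℝ))) hU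
    (Eventually.of_forall fun z => (by fun_prop : Measurable _).aestronglyMeasurable)
    (integrableOn_rpow_mul_cexp hq hr) (by fun_prop : Measurable _).aestronglyMeasurable ?_
    (integrableOn_rpow_mul_exp_neg_mul_rpow (by linarith) one_pos (by linarith)) ?_
    ).2.differentiableAt
  · filter_upwards [ae_restrict_mem measurableSet_Ioi] with t ht z hz
    have h0 : (0 : ℝ) < t := ht
    have hz' : r.re / 2 < z.re := hz
    rw [norm_mul, norm_mul, Complex.norm_exp, Complex.norm_real, Real.norm_eq_abs,
      abs_of_nonneg (by positivity : 0 ≤ t ^ q), Real.rpow_add_one h0.ne', Real.rpow_one]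
    simp only [Complex.mul_re, Complex.neg_re, Complex.ofReal_re,
      Complex.ofReal_im, mul_zero, sub_zero, neg_mul, one_mul, norm_neg, Complex.norm_real,
      Real.norm_eq_abs, abs_of_pos h0]
    rw [mul_right_comm, ← mul_assoc]
    gcongr
  · refine Eventually.of_forall fun t z _ => ?_
    exact (((hasDerivAt_id z).neg.mul_const (t : ℂ)).cexp).const_mul _

/-- For real `r > 0` this is Euler's integral. Both sides are analytic on the right half-plane, and
the identity theorem at `z = 1` extends it to complex rates. -/
theorem mul_integral_rpow_mul_cexp {q : ℝ} (hq : -1 < q) {r : ℂ} (hr : 0 < r.re) :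
    r * ∫ t in Set.Ioi (0 : ℝ), ((t ^ q : ℝ) : ℂ) * Complex.exp (-r * t) =
      r ^ (-q : ℂ) * Complex.Gamma (q + 1) := by
  have hopen : IsOpen {z : ℂ | 0 < z.re} := isOpen_lt continuous_const Complex.continuous_re
  have hf : AnalyticOnNhd ℂ (fun z : ℂ => z * ∫ t in Set.Ioi (0 : ℝ),
      ((t ^ q : ℝ) : ℂ) * Complex.exp (-z * t)) {z : ℂ | 0 < z.re} :=
    DifferentiableOn.analyticOnNhd (fun z hz => (differentiableAt_id.mul
      (differentiableAt_integral_rpow_mul_cexp hq hz)).differentiableWithinAt) hopen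
  have hg : AnalyticOnNhd ℂ (fun z : ℂ => z ^ (-q : ℂ) * Complex.Gamma (q + 1))
      {z : ℂ | 0 < z.re} := by
    refine DifferentiableOn.analyticOnNhd (fun z hz => ?_) hopen
    exact ((differentiableAt_id.cpow_const (Or.inl hz)).mul_const _).differentiableWithinAt
  refine hf.eqOn_of_preconnected_of_frequently_eq hg (convex_halfSpace_re_gt 0).isPreconnected
    (z₀ := 1) (by simp) ?_ hr
  have hreal : ∀ x : ℝ, 0 < x → (x : ℂ) * ∫ t in Set.Ioi (0 : ℝ),
      ((t ^ q : ℝ) : ℂ) * Complex.exp (-x * t) = (x : ℂ) ^ (-q : ℂ) * Complex.Gamma (q + 1) := by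
    intro x hx
    have hx0 : (x : ℂ) ≠ 0 := by exact_mod_cast hx.ne'
    have h := Complex.integral_cpow_mul_exp_neg_mul_Ioi (a := (q : ℂ) + 1) (r := x)
      (by simp; linarith) hx
    have h2 : ∫ t in Set.Ioi (0 : ℝ), ((t ^ q : ℝ) : ℂ) * Complex.exp (-x * t) =
        ∫ t in Set.Ioi (0 : ℝ), (t : ℂ) ^ ((q : ℂ) + 1 - 1) * Complex.exp (-(x * t)) := by
      refine setIntegral_congr_fun measurableSet_Ioi fun t ht => ?_
      simp only [Complex.ofReal_cpow (le_of_lt ht), add_sub_cancel_right, neg_mul]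
    have harg : (x : ℂ).arg ≠ Real.pi := by
      rw [Complex.arg_ofReal_of_nonneg hx.le]; exact Real.pi_pos.ne
    rw [h2, h, one_div, Complex.inv_cpow _ _ harg, ← Complex.cpow_neg, ← mul_assoc]
    congr 1
    nth_rewrite 1 [← Complex.cpow_one (x : ℂ)]
    rw [← Complex.cpow_add _ _ hx0]
    congr 1; ring
  have hmap : Tendsto (fun x : ℝ => (x : ℂ)) (𝓝[≠] 1) (𝓝[≠] 1) := by
    refine tendsto_nhdsWithin_iff.2 ⟨?_, ?_⟩
    · exact (Complex.continuous_ofReal.tendsto 1).mono_left nhdsWithin_le_nhds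
    · filter_upwards [self_mem_nhdsWithin] with x hx
      simpa using hx
  refine hmap.frequently (Eventually.frequently ?_)
  filter_upwards [nhdsWithin_le_nhds (lt_mem_nhds one_pos)] with x hx
  exact hreal x hx

/-- The damping `e^{-εt}` makes the two exponentials separately integrable after one integration by
parts, which raises the power `t^(q-1)` to `t^q`. Laplace transforms at the rates `ε` and `ε - i`
remain. -/
theorem integral_exp_mul_exp_I_sub_one {q : ℝ} (hq : q ∈ Set.Ioo (-1 : ℝ) 0) {ε : ℝ}
    (hε : 0 < ε) :
    ∫ t in Set.Ioi (0 : ℝ), Complex.exp (-ε * t) *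
        ((Complex.exp (Complex.I * t) - 1) * ((t ^ (q - 1) : ℝ) : ℂ)) =
      Complex.Gamma (q + 1) / q * ((ε - Complex.I) ^ (-q : ℂ) - (ε : ℂ) ^ (-q : ℂ)) := by
  have hq0 : (q : ℂ) ≠ 0 := by exact_mod_cast hq.2.ne
  have hr1 : 0 < ((ε : ℂ) - Complex.I).re := by simpa using hε
  have hr2 : 0 < (ε : ℂ).re := by simpa using hε
  have i1 := integrableOn_rpow_mul_cexp hq.1 hr1
  have i2 := integrableOn_rpow_mul_cexp hq.1 hr2
  have e1 := mul_integral_rpow_mul_cexp hq.1 hr1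
  have e2 := mul_integral_rpow_mul_cexp hq.1 hr2
  -- The boundary term of the integration by parts: it is `O(t^(q+1))` at `0` and `O(t^q)` at
  -- infinity, so it vanishes at both ends.
  set A : ℝ → ℂ := fun t => Complex.exp (-ε * t) *
    ((Complex.exp (Complex.I * t) - 1) * ((t ^ q : ℝ) : ℂ)) / q with hA
  set B : ℝ → ℂ := fun t => Complex.exp (-ε * t) *
    ((Complex.exp (Complex.I * t) - 1) * ((t ^ (q - 1) : ℝ) : ℂ)) with hB
  have hexp : ∀ t : ℝ, 0 ≤ t → ‖Complex.exp (-ε * t)‖ ≤ 1 := by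
    intro t ht
    rw [Complex.norm_exp]
    simp only [Complex.mul_re, Complex.neg_re, Complex.ofReal_re, Complex.neg_im,
      Complex.ofReal_im, neg_zero, mul_zero, sub_zero, Real.exp_le_one_iff]
    nlinarith
  have iB : IntegrableOn B (Set.Ioi 0) := by
    refine Integrable.mono' (integrableOn_min_mul_rpow hq)
      (by fun_prop : Measurable B).aestronglyMeasurable ?_
    filter_upwards [ae_restrict_mem measurableSet_Ioi] with t ht
    have h0 : (0 : ℝ) < t := ht
    rw [hB, norm_mul, norm_mul, Complex.norm_real, Real.norm_eq_abs,
      abs_of_nonneg (by positivity : 0 ≤ t ^ (q - 1))]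
    refine (mul_le_of_le_one_left (by positivity) (hexp t h0.le)).trans ?_
    gcongr
    exact norm_exp_I_mul_sub_one_le_min h0.le
  have hAn : ∀ t > 0, ‖A t‖ ≤ min t 2 * t ^ q / |q| := by
    intro t h0
    rw [hA, norm_div, norm_mul, norm_mul, Complex.norm_real, Complex.norm_real, Real.norm_eq_abs,
      Real.norm_eq_abs, abs_of_nonneg (by positivity : 0 ≤ t ^ q)]
    refine div_le_div_of_nonneg_right ?_ (abs_nonneg q)
    refine (mul_le_of_le_one_left (by positivity) (hexp t h0.le)).trans ?_
    gcongr
    exact norm_exp_I_mul_sub_one_le_min h0.le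
  have A0 : A 0 = 0 := by simp [hA]
  have hcont : ContinuousWithinAt A (Set.Ici 0) 0 := by
    rw [← Set.Ioi_insert, continuousWithinAt_insert_self, ContinuousWithinAt, A0]
    have h := (tendsto_rpow_nhdsGT_zero (q := q + 1) (by linarith [hq.1])).div_const |q|
    rw [zero_div] at h
    refine squeeze_zero_norm' ?_ h
    filter_upwards [self_mem_nhdsWithin] with t ht
    have h0 : (0 : ℝ) < t := ht
    refine (hAn t h0).trans ?_
    rw [Real.rpow_add_one h0.ne', mul_comm]
    gcongr
    exact min_le_left _ _
  have htop : Tendsto A atTop (𝓝 0) := by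
    have h := ((tendsto_rpow_neg_atTop (y := -q) (by linarith [hq.2])).const_mul 2).div_const |q|
    simp only [neg_neg, mul_zero, zero_div] at h
    refine squeeze_zero_norm' ?_ h
    filter_upwards [eventually_gt_atTop 0] with t h0
    refine (hAn t h0).trans ?_
    gcongr
    exact min_le_right _ _
  have hd : ∀ t ∈ Set.Ioi (0 : ℝ), HasDerivAt A (B t +
      ((ε : ℂ) * (((t ^ q : ℝ) : ℂ) * Complex.exp (-ε * t)) -
        (ε - Complex.I) * (((t ^ q : ℝ) : ℂ) * Complex.exp (-(ε - Complex.I) * t))) / q) t := by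
    intro t ht
    have h0 : (0 : ℝ) < t := ht
    have hid : HasDerivAt (fun t : ℝ => (t : ℂ)) 1 t := Complex.ofRealCLM.hasDerivAt
    have d1 := (hid.const_mul (-ε : ℂ)).cexp
    have d2 := ((hid.const_mul Complex.I).cexp).sub_const (1 : ℂ)
    have d3 := (Real.hasDerivAt_rpow_const (p := q) (Or.inl h0.ne')).ofReal_comp
    refine ((d1.mul (d2.mul d3)).div_const (q : ℂ)).congr_deriv ?_
    have h3 : Complex.exp (-(ε - Complex.I) * t) =
        Complex.exp (-ε * t) * Complex.exp (Complex.I * t) := by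
      rw [← Complex.exp_add]; ring_nf
    simp only [h3, hB, Pi.mul_apply]
    push_cast
    field_simp
    ring
  have i3 : IntegrableOn (fun t : ℝ => ((ε : ℂ) * (((t ^ q : ℝ) : ℂ) * Complex.exp (-ε * t)) -
      (ε - Complex.I) * (((t ^ q : ℝ) : ℂ) * Complex.exp (-(ε - Complex.I) * t))) / q)
      (Set.Ioi 0) :=
    ((i2.const_mul (ε : ℂ)).sub (i1.const_mul (ε - Complex.I))).div_const (q : ℂ)
  have key := integral_Ioi_of_hasDerivAt_of_tendsto hcont hd (iB.add i3) htop
  rw [integral_add iB i3,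
    integral_div, integral_sub (i2.const_mul (ε : ℂ)) (i1.const_mul (ε - Complex.I)),
    integral_const_mul, integral_const_mul, e1, e2, A0] at key
  rw [eq_comm, ← sub_eq_zero] at key
  linear_combination -key

/-- Abel summation: let `ε → 0⁺` in the damped identity. The term `ε^(-q)` disappears because `q <
0`. -/
theorem integral_exp_I_sub_one_mul_rpow {q : ℝ} (hq : q ∈ Set.Ioo (-1 : ℝ) 0) :
    ∫ t in Set.Ioi (0 : ℝ), (Complex.exp (Complex.I * t) - 1) * ((t ^ (q - 1) : ℝ) : ℂ) =
      Complex.Gamma (q + 1) / q * (-Complex.I) ^ (-q : ℂ) := by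
  have hL : Tendsto (fun ε : ℝ => ∫ t in Set.Ioi (0 : ℝ), Complex.exp (-ε * t) *
      ((Complex.exp (Complex.I * t) - 1) * ((t ^ (q - 1) : ℝ) : ℂ))) (𝓝[>] 0)
      (𝓝 (∫ t in Set.Ioi (0 : ℝ),
        (Complex.exp (Complex.I * t) - 1) * ((t ^ (q - 1) : ℝ) : ℂ))) := by
    refine tendsto_integral_filter_of_dominated_convergence (fun t : ℝ => min t 2 * t ^ (q - 1))
      (Eventually.of_forall fun ε => (by fun_prop : Measurable _).aestronglyMeasurable) ?_
      (integrableOn_min_mul_rpow hq) ?_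
    · filter_upwards [self_mem_nhdsWithin] with ε hε
      filter_upwards [ae_restrict_mem measurableSet_Ioi] with t ht
      have h0 : (0 : ℝ) < t := ht
      have hε0 : (0 : ℝ) < ε := hε
      have hexp : ‖Complex.exp (-ε * t)‖ ≤ 1 := by
        rw [Complex.norm_exp]
        simp only [Complex.mul_re, Complex.neg_re, Complex.ofReal_re, Complex.neg_im,
          Complex.ofReal_im, neg_zero, mul_zero, sub_zero, Real.exp_le_one_iff]
        nlinarith
      rw [norm_mul, norm_mul, Complex.norm_real, Real.norm_eq_abs,
        abs_of_nonneg (by positivity : 0 ≤ t ^ (q - 1))]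
      refine (mul_le_of_le_one_left (by positivity) hexp).trans ?_
      gcongr
      exact norm_exp_I_mul_sub_one_le_min h0.le
    · refine Eventually.of_forall fun t => ?_
      have h : Continuous fun ε : ℝ => Complex.exp (-ε * t) *
        ((Complex.exp (Complex.I * t) - 1) * ((t ^ (q - 1) : ℝ) : ℂ)) := by fun_prop
      have h' := h.tendsto 0
      simp only [Complex.ofReal_zero, neg_zero, zero_mul, Complex.exp_zero, one_mul] at h'
      exact h'.mono_left nhdsWithin_le_nhds
  have hR : Tendsto (fun ε : ℝ => Complex.Gamma (q + 1) / q *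
      ((ε - Complex.I) ^ (-q : ℂ) - (ε : ℂ) ^ (-q : ℂ))) (𝓝[>] 0)
      (𝓝 (Complex.Gamma (q + 1) / q * (-Complex.I) ^ (-q : ℂ))) := by
    have c1 : ContinuousAt (fun ε : ℝ => ((ε : ℂ) - Complex.I) ^ (-q : ℂ)) 0 := by
      refine ContinuousAt.cpow (by fun_prop) continuousAt_const ?_
      right; simp
    have c2 : ContinuousAt (fun ε : ℝ => (ε : ℂ) ^ (-q : ℂ)) 0 :=
      Complex.continuousAt_ofReal_cpow_const _ _ (Or.inl (by simpa using hq.2))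
    have h := ((c1.sub c2).const_mul (Complex.Gamma (q + 1) / q)).tendsto
    have hz : (0 : ℂ) ^ (-q : ℂ) = 0 := Complex.zero_cpow (by simpa using hq.2.ne)
    simp only [Pi.sub_apply, Complex.ofReal_zero, zero_sub, hz, sub_zero] at h
    exact h.mono_left nhdsWithin_le_nhds
  refine tendsto_nhds_unique hL (hR.congr' ?_)
  filter_upwards [self_mem_nhdsWithin] with ε hε
  exact (integral_exp_mul_exp_I_sub_one hq hε).symm

/-- The imaginary part of the Mellin transform, in terms of the real Gamma function. -/
theorem im_Gamma_div_mul_neg_I_cpow (q : ℝ) :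
    (Complex.Gamma (q + 1) / q * (-Complex.I) ^ (-q : ℂ)).im =
      Real.Gamma (q + 1) / q * Real.sin (Real.pi * q / 2) := by
  have h1 : (-Complex.I) ^ (-q : ℂ) = Complex.exp ((Real.pi * q / 2 : ℝ) * Complex.I) := by
    rw [Complex.cpow_def_of_ne_zero (by simp), Complex.log_neg_I]
    congr 1; push_cast; ring
  have h2 : Complex.Gamma (q + 1) / q = ((Real.Gamma (q + 1) / q : ℝ) : ℂ) := by
    push_cast
    rw [← Complex.Gamma_ofReal]; push_cast; rfl
  rw [h1, h2, Complex.im_ofReal_mul, Complex.exp_ofReal_mul_I_im]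

/-! ### Asymptotics of the half-line Fourier integral -/

/-- The half-line Fourier integral of `rec`. -/
def halfFourier (s a β x : ℝ) : ℂ :=
  ∫ ξ in Set.Ioi (0 : ℝ), Complex.exp (Complex.I * ξ * x) * rec s a β ξ

/-- The half-line Fourier integral of `rec'''`, with the divergence at the origin removed. -/
def halfFourier₃ (s a β x : ℝ) : ℂ :=
  ∫ ξ in Set.Ioi (0 : ℝ), (Complex.exp (Complex.I * ξ * x) - 1) * rec''' s a β ξ

/-- The limit of `x ^ (2s - 2) * halfFourier₃ s a β x` as `x → ∞`. -/
def limitConst (s a : ℝ) : ℂ :=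
  ((-(2 * s * (2 * s - 1) * (2 * s - 2) / a ^ 2) : ℝ) : ℂ) *
    ∫ t in Set.Ioi (0 : ℝ), (Complex.exp (Complex.I * t) - 1) * ((t ^ (2 * s - 3) : ℝ) : ℂ)

/-- With `q = 2s - 2` the factor `2s - 2` cancels, the remaining product is `2s (2s-1) Γ(2s-1) =
Γ(2s+1)`, and the sine of `sπ - π` supplies the sign. -/
theorem im_limitConst {s a : ℝ} (hs : s ∈ Set.Ioo (1 / 2 : ℝ) 1) (ha : 0 < a) :
    (limitConst s a).im = Real.pi * K₁ s a := by
  obtain ⟨hs1, hs2⟩ := hs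
  have h := integral_exp_I_sub_one_mul_rpow (q := 2 * s - 2) ⟨by linarith, by linarith⟩
  have hG : ∫ z in Set.Ioi (0 : ℝ), z ^ (2 * s) * Real.exp (-z) =
      2 * s * ((2 * s - 1) * Real.Gamma (2 * s - 1)) := by
    have e1 : Real.Gamma (2 * s + 1) = 2 * s * Real.Gamma (2 * s) :=
      Real.Gamma_add_one (by linarith)
    have e2 := Real.Gamma_add_one (s := 2 * s - 1) (by linarith)
    rw [sub_add_cancel] at e2
    rw [← e2, ← e1, Real.Gamma_eq_integral (by linarith)]
    refine setIntegral_congr_fun measurableSet_Ioi fun t _ => ?_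
    simp only [add_sub_cancel_right, mul_comm]
  rw [limitConst, show 2 * s - 3 = 2 * s - 2 - 1 by ring, h, Complex.im_ofReal_mul,
    im_Gamma_div_mul_neg_I_cpow, K₁, hG, show Real.pi * (2 * s - 2) / 2 = s * Real.pi - Real.pi by
      ring, Real.sin_sub_pi, show 2 * s - 2 + 1 = 2 * s - 1 by ring]
  rw [show 2 * s - 2 = 2 * (s - 1) by ring]
  have : s - 1 ≠ 0 := by linarith
  have hpi := Real.pi_ne_zero
  field_simp

theorem tendsto_rpow_mul_halfFourier₃ {s a β : ℝ} (hs : s ∈ Set.Ioo (1 / 2 : ℝ) 1) (ha : 0 < a)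
    (hβ : |β| < critSpeed s a) :
    Tendsto (fun x : ℝ => ((x ^ (2 * s - 2) : ℝ) : ℂ) * halfFourier₃ s a β x) atTop
      (𝓝 (limitConst s a)) := by
  obtain ⟨C, hC⟩ := exists_abs_rec'''_le hs ha hβ
  have hmeas : Measurable (rec''' s a β) := by
    unfold rec''' fac''' fac'' fac' fac; fun_prop
  have hlim : Tendsto (fun x : ℝ => ∫ t in Set.Ioi (0 : ℝ), (Complex.exp (Complex.I * t) - 1) *
      ((x ^ (2 * s - 3) * rec''' s a β (x⁻¹ * t) : ℝ) : ℂ)) atTop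
      (𝓝 (∫ t in Set.Ioi (0 : ℝ), (Complex.exp (Complex.I * t) - 1) *
        ((-(2 * s * (2 * s - 1) * (2 * s - 2) / a ^ 2) * t ^ (2 * s - 3) : ℝ) : ℂ))) := by
    refine tendsto_integral_filter_of_dominated_convergence
      (fun t : ℝ => C * (min t 2 * t ^ (2 * s - 2 - 1)))
      (Eventually.of_forall fun x => (by fun_prop : Measurable _).aestronglyMeasurable) ?_
      ((integrableOn_min_mul_rpow ⟨by linarith [hs.1], by linarith [hs.2]⟩).const_mul C) ?_
    · filter_upwards [eventually_gt_atTop 0] with x hx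
      filter_upwards [ae_restrict_mem measurableSet_Ioi] with t ht
      have h0 : (0 : ℝ) < t := ht
      have h1 := hC (x⁻¹ * t) (by positivity)
      rw [Real.mul_rpow (by positivity) h0.le, Real.inv_rpow hx.le] at h1
      rw [norm_mul, Complex.norm_real, Real.norm_eq_abs, abs_mul,
        abs_of_nonneg (by positivity : 0 ≤ x ^ (2 * s - 3)), show 2 * s - 2 - 1 = 2 * s - 3 by ring]
      calc _ ≤ min t 2 * (x ^ (2 * s - 3) * (C * ((x ^ (2 * s - 3))⁻¹ * t ^ (2 * s - 3)))) := by
            gcongr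
            exact norm_exp_I_mul_sub_one_le_min h0.le
        _ = _ := by field_simp
    · filter_upwards [ae_restrict_mem measurableSet_Ioi] with t ht
      have h0 : (0 : ℝ) < t := ht
      have hx : Tendsto (fun x : ℝ => x⁻¹ * t) atTop (𝓝[>] 0) := by
        refine tendsto_nhdsWithin_iff.2 ⟨?_, ?_⟩
        · simpa using tendsto_inv_atTop_zero.mul_const t
        · filter_upwards [eventually_gt_atTop 0] with x hx
          exact Set.mem_Ioi.2 (by positivity)
      have h := ((tendsto_rpow_mul_rec'''_zero (β := β) hs ha).comp hx).mul_const (t ^ (2 * s - 3))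
      refine Tendsto.const_mul _ ((Complex.continuous_ofReal.tendsto _).comp (h.congr' ?_))
      filter_upwards [eventually_gt_atTop 0] with x hx
      have e1 : (x⁻¹) ^ (3 - 2 * s) = x ^ (2 * s - 3) := by
        rw [Real.inv_rpow hx.le, ← Real.rpow_neg hx.le, neg_sub]
      have e2 : t ^ (3 - 2 * s) * t ^ (2 * s - 3) = 1 := by rw [← Real.rpow_add h0]; simp
      simp only [Function.comp_apply]
      rw [Real.mul_rpow (by positivity) h0.le, e1]
      linear_combination (x ^ (2 * s - 3) * rec''' s a β (x⁻¹ * t)) * e2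
  have hconst : ∫ t in Set.Ioi (0 : ℝ), (Complex.exp (Complex.I * t) - 1) *
        ((-(2 * s * (2 * s - 1) * (2 * s - 2) / a ^ 2) * t ^ (2 * s - 3) : ℝ) : ℂ) =
      limitConst s a := by
    rw [limitConst, ← integral_const_mul]
    refine integral_congr_ae (Eventually.of_forall fun t => ?_)
    simp only [Complex.ofReal_mul]; ring
  rw [hconst] at hlim
  refine hlim.congr' ?_
  filter_upwards [eventually_gt_atTop 0] with x hx
  have hsub := integral_comp_mul_left_Ioi
    (fun ξ : ℝ => (Complex.exp (Complex.I * ξ * x) - 1) * (rec''' s a β ξ : ℂ)) 0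
    (inv_pos.2 hx)
  rw [mul_zero, inv_inv] at hsub
  -- One power of `x` pays for the Jacobian of `ξ = t/x`; the rest normalises `rec'''`.
  have e1 : x ^ (2 * s - 2) = x ^ (2 * s - 3) * x := by
    rw [← Real.rpow_add_one hx.ne']; ring_nf
  rw [halfFourier₃, e1, Complex.ofReal_mul, mul_assoc, ← Complex.real_smul (x := x), ← hsub,
    ← integral_const_mul]
  refine integral_congr_ae (Eventually.of_forall fun t => ?_)
  have e2 : Complex.I * ((x⁻¹ * t : ℝ) : ℂ) * x = Complex.I * t := by
    have : (x : ℂ) ≠ 0 := by exact_mod_cast hx.ne'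
    push_cast; field_simp
  simp only [e2]
  rw [Complex.ofReal_mul]
  ring

/-- One factor of `lam` has an integrable reciprocal. -/
theorem integrable_factor_inv {s a β : ℝ} (hs : s ∈ Set.Ioo (1 / 2 : ℝ) 1) (ha : 0 < a)
    (hβ : |β| < critSpeed s a) :
    Integrable (fun ξ : ℝ => 1 / (|ξ| ^ (2 * s) + a + β * ξ)) := by
  obtain ⟨c, hc, h⟩ := exists_mul_le_factor hs.1 ha hβ
  have hi := (integrable_one_add_norm (E := ℝ) (μ := volume) (r := 2 * s)
    (by simp; linarith [hs.1])).const_mul (4 / c)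
  refine hi.mono' (by fun_prop : Measurable _).aestronglyMeasurable
    (Eventually.of_forall fun ξ => ?_)
  have h1 : 0 < c * (1 + |ξ| ^ (2 * s)) := by positivity
  -- The constant `4` bounds `2^(2s)`, since `s < 1`.
  have h2 : (1 + |ξ|) ^ (2 * s) ≤ 4 * (1 + |ξ| ^ (2 * s)) := by
    have hs0 : 0 ≤ 2 * s := by linarith [hs.1]
    have h3 : (2 : ℝ) ^ (2 * s) ≤ 4 := by
      have := Real.rpow_le_rpow_of_exponent_le one_le_two (by linarith [hs.2] : 2 * s ≤ (2 : ℝ))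
      norm_num at this; exact this
    have h4 : max 1 |ξ| ^ (2 * s) ≤ 1 + |ξ| ^ (2 * s) := by
      have h5 : 0 ≤ |ξ| ^ (2 * s) := by positivity
      rcases max_cases 1 |ξ| with h | h <;> rw [h.1]
      · rw [Real.one_rpow]; linarith
      · linarith
    calc (1 + |ξ|) ^ (2 * s) ≤ (2 * max 1 |ξ|) ^ (2 * s) := by
          gcongr; linarith [le_max_left 1 |ξ|, le_max_right 1 |ξ|]
      _ = 2 ^ (2 * s) * max 1 |ξ| ^ (2 * s) := Real.mul_rpow (by norm_num) (by positivity)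
      _ ≤ _ := by gcongr
  rw [Real.norm_eq_abs, abs_of_pos (by have := h ξ; have := h1.trans_le this; positivity),
    Real.norm_eq_abs, Real.rpow_neg (by positivity)]
  calc 1 / (|ξ| ^ (2 * s) + a + β * ξ) ≤ 1 / (c * (1 + |ξ| ^ (2 * s))) :=
        one_div_le_one_div_of_le h1 (h ξ)
    _ = 4 / c * (4 * (1 + |ξ| ^ (2 * s)))⁻¹ := by field_simp
    _ ≤ _ := by gcongr

theorem integrableOn_rec {s a β : ℝ} (hs : s ∈ Set.Ioo (1 / 2 : ℝ) 1) (ha : 0 < a)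
    (hβ : |β| < critSpeed s a) : IntegrableOn (rec s a β) (Set.Ioi 0) := by
  refine (integrable_factor_inv hs ha hβ).integrableOn.congr_fun (fun ξ hξ => ?_) measurableSet_Ioi
  have h0 : (0 : ℝ) < ξ := hξ
  simp only [rec, fac, abs_of_pos h0]
  ring_nf

theorem integral_Ioi_of_hasDerivAt_of_tendsto_nhdsGT {f f' : ℝ → ℂ} {c : ℝ} {L M : ℂ}
    (hd : ∀ x ∈ Set.Ioi c, HasDerivAt f (f' x) x) (hi : IntegrableOn f' (Set.Ioi c))
    (hL : Tendsto f (𝓝[>] c) (𝓝 L)) (hM : Tendsto f atTop (𝓝 M)) :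
    ∫ x in Set.Ioi c, f' x = M - L := by
  have heq : ∀ x ∈ Set.Ioi c, Function.update f c L x = f x := fun x hx =>
    Function.update_of_ne (ne_of_gt hx) _ _
  have h := integral_Ioi_of_hasDerivAt_of_tendsto (f := Function.update f c L) (f' := f') (a := c)
    (m := M) ?_ (fun x hx => (hd x hx).congr_of_eventuallyEq ?_) hi (hM.congr' ?_)
  · rwa [Function.update_self] at h
  · rw [continuousWithinAt_update_same]
    exact hL.mono_left (nhdsWithin_mono _ fun x hx => lt_of_le_of_ne hx.1 (Ne.symm hx.2))
  · filter_upwards [Ioi_mem_nhds hx] with y hy using heq y hy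
  · filter_upwards [eventually_gt_atTop c] with y hy using (heq y hy).symm

/-- Three integrations by parts performed at once. The first two boundary terms at `0` are purely
imaginary and purely real respectively, which is what makes them cancel in the kernels. -/
theorem halfFourier_eq {s a β x : ℝ} (hs : s ∈ Set.Ioo (1 / 2 : ℝ) 1) (ha : 0 < a)
    (hβ : |β| < critSpeed s a) (hx : 0 < x) :
    halfFourier s a β x = Complex.I * (1 / (a * x) : ℝ) + (β / (a ^ 2 * x ^ 2) : ℝ)
      - Complex.I * ((x ^ 3)⁻¹ : ℝ) * halfFourier₃ s a β x := by
  have hx0 : (x : ℂ) ≠ 0 := by exact_mod_cast hx.ne'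
  have ha0 : (a : ℂ) ≠ 0 := by exact_mod_cast ha.ne'
  have hI := Complex.I_ne_zero
  obtain ⟨C, hC⟩ := exists_abs_rec'''_le hs ha hβ
  have hm0 : Measurable (rec s a β) := by unfold rec fac; fun_prop
  have hm3 : Measurable (rec''' s a β) := by
    unfold rec''' fac''' fac'' fac' fac; fun_prop
  set e : ℝ → ℂ := fun ξ => Complex.exp (Complex.I * ξ * x) with he
  have hen : ∀ ξ, ‖e ξ‖ = 1 := fun ξ => by
    rw [he]; simp only
    rw [mul_assoc, ← Complex.ofReal_mul, Complex.norm_exp_I_mul_ofReal]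
  have hen1 : ∀ ξ ≥ 0, ‖e ξ - 1‖ ≤ min (ξ * x) 2 := fun ξ hξ => by
    have := norm_exp_I_mul_sub_one_le_min (t := ξ * x) (by positivity)
    simpa [he, mul_assoc] using this
  have hecont : Continuous e := by fun_prop
  -- In the last term `e - 1` replaces `e` as a primitive of `i x e`: it vanishes at `0`,
  -- compensating the singularity of `rec''` and making the integral with `rec'''` converge.
  set A : ℝ → ℂ := fun ξ => e ξ * rec s a β ξ / (Complex.I * x)
    - e ξ * rec' s a β ξ / (Complex.I * x) ^ 2
    + (e ξ - 1) * rec'' s a β ξ / (Complex.I * x) ^ 3 with hA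
  have i0 : IntegrableOn (fun ξ : ℝ => e ξ * rec s a β ξ) (Set.Ioi 0) := by
    refine (integrableOn_rec hs ha hβ).norm.mono'
      (by fun_prop : Measurable _).aestronglyMeasurable (Eventually.of_forall fun ξ => ?_)
    rw [norm_mul, hen, one_mul, Complex.norm_real]
  have i3 : IntegrableOn (fun ξ : ℝ => (e ξ - 1) * rec''' s a β ξ) (Set.Ioi 0) := by
    refine Integrable.mono' ((integrableOn_min_mul_rpow (q := 2 * s - 2) ⟨by linarith [hs.1],
      by linarith [hs.2]⟩).const_mul (max x 1 * C))
      (by fun_prop : Measurable _).aestronglyMeasurable ?_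
    filter_upwards [ae_restrict_mem measurableSet_Ioi] with ξ hξ
    have h0 : (0 : ℝ) < ξ := hξ
    rw [norm_mul, Complex.norm_real, Real.norm_eq_abs, show 2 * s - 2 - 1 = 2 * s - 3 by ring]
    have h1 : ‖e ξ - 1‖ ≤ max x 1 * min ξ 2 := by
      refine (hen1 ξ h0.le).trans ?_
      have hm : 1 ≤ max x 1 := le_max_right _ _
      rw [mul_min_of_nonneg _ _ (by positivity)]
      refine min_le_min ?_ (by linarith)
      rw [mul_comm]; gcongr; exact le_max_left _ _
    calc ‖e ξ - 1‖ * |rec''' s a β ξ| ≤ (max x 1 * min ξ 2) * (C * ξ ^ (2 * s - 3)) :=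
          mul_le_mul h1 (hC ξ h0) (abs_nonneg _) ((norm_nonneg _).trans h1)
      _ = _ := by ring
  have hd : ∀ ξ ∈ Set.Ioi (0 : ℝ), HasDerivAt A (e ξ * rec s a β ξ +
      (e ξ - 1) * rec''' s a β ξ / (Complex.I * x) ^ 3) ξ := by
    intro ξ hξ
    have h0 : (0 : ℝ) < ξ := hξ
    have hf := (fac_pos hs ha hβ h0).ne'
    have hid : HasDerivAt (fun t : ℝ => (t : ℂ)) 1 ξ := Complex.ofRealCLM.hasDerivAt
    have de := ((hid.const_mul Complex.I).mul_const (x : ℂ)).cexp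
    have d0 := (hasDerivAt_rec h0 hf).ofReal_comp
    have d1 := (hasDerivAt_rec' h0 hf).ofReal_comp
    have d2 := (hasDerivAt_rec'' h0 hf).ofReal_comp
    refine (((de.mul d0).div_const (Complex.I * x)).sub ((de.mul d1).div_const
      ((Complex.I * x) ^ 2)) |>.add (((de.sub_const 1).mul d2).div_const
      ((Complex.I * x) ^ 3))).congr_deriv ?_
    simp only [he]
    field_simp
    ring
  have hL : Tendsto A (𝓝[>] 0) (𝓝 ((1 / a : ℝ) / (Complex.I * x)
      - (-(β / a ^ 2) : ℝ) / (Complex.I * x) ^ 2)) := by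
    have te : Tendsto e (𝓝[>] 0) (𝓝 1) := by
      have := hecont.tendsto 0
      simp only [he, Complex.ofReal_zero, mul_zero, zero_mul, Complex.exp_zero] at this
      exact this.mono_left nhdsWithin_le_nhds
    have t0 := (te.mul ((Complex.continuous_ofReal.tendsto _).comp
      (tendsto_rec_zero (β := β) hs ha))).div_const (Complex.I * x)
    have t1 := (te.mul ((Complex.continuous_ofReal.tendsto _).comp
      (tendsto_rec'_zero (β := β) hs ha))).div_const ((Complex.I * x) ^ 2)
    have t2 : Tendsto (fun ξ : ℝ => (e ξ - 1) * rec'' s a β ξ) (𝓝[>] 0) (𝓝 0) := by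
      have h := ((tendsto_mul_rec''_zero (β := β) hs ha).norm).const_mul x
      rw [norm_zero, mul_zero] at h
      refine squeeze_zero_norm' ?_ h
      filter_upwards [self_mem_nhdsWithin] with ξ hξ
      have h0 : (0 : ℝ) < ξ := hξ
      rw [norm_mul, Complex.norm_real, norm_mul, Real.norm_eq_abs ξ, abs_of_pos h0]
      calc ‖e ξ - 1‖ * ‖rec'' s a β ξ‖ ≤ (ξ * x) * ‖rec'' s a β ξ‖ := by
            gcongr; exact (hen1 ξ h0.le).trans (min_le_left _ _)
        _ = _ := by ring
    have h := (t0.sub t1).add (t2.div_const ((Complex.I * x) ^ 3))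
    simpa only [one_mul, zero_div, add_zero] using! h
  have htop : Tendsto A atTop (𝓝 0) := by
    have bd : ∀ (E : ℝ → ℂ) (f : ℝ → ℝ), (∀ ξ ≥ 0, ‖E ξ‖ ≤ 2) → Tendsto f atTop (𝓝 0) →
        Tendsto (fun ξ => E ξ * f ξ) atTop (𝓝 0) := by
      intro E f hE hf
      have h := hf.norm.const_mul 2
      rw [norm_zero, mul_zero] at h
      refine squeeze_zero_norm' ?_ h
      filter_upwards [eventually_ge_atTop 0] with ξ hξ
      rw [norm_mul, Complex.norm_real]
      gcongr
      exact hE ξ hξ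
    have hE : ∀ ξ ≥ 0, ‖e ξ‖ ≤ 2 := fun ξ _ => by rw [hen]; norm_num
    have hE1 : ∀ ξ ≥ 0, ‖e ξ - 1‖ ≤ 2 := fun ξ hξ => (hen1 ξ hξ).trans (min_le_right _ _)
    have h := (((bd _ _ hE (tendsto_rec_atTop hs ha hβ)).div_const (Complex.I * x)).sub
      ((bd _ _ hE (tendsto_rec'_atTop hs ha hβ)).div_const ((Complex.I * x) ^ 2))).add
      ((bd _ _ hE1 (tendsto_rec''_atTop hs ha hβ)).div_const ((Complex.I * x) ^ 3))
    simpa only [zero_div, sub_zero, add_zero] using! h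
  have key := integral_Ioi_of_hasDerivAt_of_tendsto_nhdsGT hd (i0.add (i3.div_const _)) hL htop
  rw [integral_add i0 (i3.div_const _), integral_div] at key
  change halfFourier s a β x + halfFourier₃ s a β x / (Complex.I * x) ^ 3 = _ at key
  rw [← eq_sub_iff_add_eq] at key
  rw [key]
  push_cast
  have hI2 : Complex.I ^ 2 = -1 := Complex.I_sq
  have hI3 : Complex.I ^ 3 = -Complex.I := by rw [pow_succ, hI2]; ring
  have hinv : 1 / Complex.I = -Complex.I := by simp
  rw [mul_pow, mul_pow, hI2, hI3]
  field_simp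
  ring_nf
  simp only [hI2]
  ring

/-! ### The kernels -/

/-- The Fourier integral of the reciprocal of one factor of `lam`. -/
def lineFourier (s a β x : ℝ) : ℂ :=
  ∫ ξ : ℝ, Complex.exp (Complex.I * ξ * x) * ((1 / (|ξ| ^ (2 * s) + a + β * ξ) : ℝ) : ℂ)

theorem norm_exp_I_mul_mul (ξ x : ℝ) : ‖Complex.exp (Complex.I * ξ * x)‖ = 1 := by
  rw [mul_assoc, ← Complex.ofReal_mul, Complex.norm_exp_I_mul_ofReal]

section

variable {s a β : ℝ}

theorem integrable_lineFourier (hs : s ∈ Set.Ioo (1 / 2 : ℝ) 1) (ha : 0 < a)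
    (hβ : |β| < critSpeed s a) (x : ℝ) : Integrable (fun ξ : ℝ =>
    Complex.exp (Complex.I * ξ * x) * ((1 / (|ξ| ^ (2 * s) + a + β * ξ) : ℝ) : ℂ)) := by
  refine (integrable_factor_inv hs ha hβ).norm.mono'
    (by fun_prop : Measurable _).aestronglyMeasurable (Eventually.of_forall fun ξ => ?_)
  rw [norm_mul, norm_exp_I_mul_mul, one_mul, Complex.norm_real]

theorem continuous_lineFourier (hs : s ∈ Set.Ioo (1 / 2 : ℝ) 1) (ha : 0 < a)
    (hβ : |β| < critSpeed s a) : Continuous (lineFourier s a β) := by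
  refine continuous_of_dominated
    (bound := fun ξ : ℝ => ‖1 / (|ξ| ^ (2 * s) + a + β * ξ)‖)
    (fun x => (by fun_prop : Measurable _).aestronglyMeasurable)
    (fun x => Eventually.of_forall fun ξ => ?_)
    (integrable_factor_inv hs ha hβ).norm (Eventually.of_forall fun ξ => by fun_prop)
  rw [norm_mul, norm_exp_I_mul_mul, one_mul, Complex.norm_real]

/-- Reflecting the negative half-line changes the sign of `β` and conjugates the exponential. -/
theorem lineFourier_eq (hs : s ∈ Set.Ioo (1 / 2 : ℝ) 1) (ha : 0 < a)
    (hβ : |β| < critSpeed s a) (x : ℝ) :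
    lineFourier s a β x = halfFourier s a β x + (starRingEnd ℂ) (halfFourier s a (-β) x) := by
  have hi := integrable_lineFourier hs ha hβ x
  rw [lineFourier, ← integral_add_compl (measurableSet_Ioi (a := (0 : ℝ))) hi, Set.compl_Ioi,
    ← neg_zero, ← integral_comp_neg_Ioi, neg_zero, halfFourier, halfFourier, ← integral_conj]
  congr 1
  · refine setIntegral_congr_fun measurableSet_Ioi fun ξ hξ => ?_
    have h0 : (0 : ℝ) < ξ := hξ
    simp only [rec, fac, abs_of_pos h0]
    ring_nf
  · refine setIntegral_congr_fun measurableSet_Ioi fun ξ hξ => ?_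
    have h0 : (0 : ℝ) < ξ := hξ
    simp only [rec, fac, abs_neg, abs_of_pos h0, map_mul, Complex.conj_ofReal,
      ← Complex.exp_conj, Complex.conj_I, Complex.ofReal_neg]
    ring_nf

end

theorem lineFourier_neg (s a β x : ℝ) : lineFourier s a β (-x) = lineFourier s a (-β) x := by
  rw [lineFourier, ← integral_neg_eq_self]
  refine integral_congr_ae (Eventually.of_forall fun ξ => ?_)
  simp

section Kernel

variable {s a b : ℝ}

theorem factor_ne_zero (hs : s ∈ Set.Ioo (1 / 2 : ℝ) 1) (ha : 0 < a)
    (hb : |b| < critSpeed s a) (ξ : ℝ) : |ξ| ^ (2 * s) + a + b * ξ ≠ 0 := by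
  obtain ⟨c, hc, h⟩ := exists_mul_le_factor hs.1 ha hb
  have : 0 < c * (1 + |ξ| ^ (2 * s)) := by positivity
  exact (this.trans_le (h ξ)).ne'

theorem symbolK_zero_zero (hs : s ∈ Set.Ioo (1 / 2 : ℝ) 1) (ha : 0 < a)
    (hb : |b| < critSpeed s a) (ξ : ℝ) : symbolK s a b ξ 0 0 =
    ((1 / (|ξ| ^ (2 * s) + a + b * ξ) : ℝ) + (1 / (|ξ| ^ (2 * s) + a + -b * ξ) : ℝ) : ℂ) / 2 := by
  have h1 := factor_ne_zero hs ha hb ξ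
  have h2 := factor_ne_zero hs ha ((abs_neg b).trans_lt hb) ξ
  rw [symbolK_eq]
  simp only [Matrix.of_apply, Matrix.cons_val_zero, lam]
  rw [← Complex.ofReal_div, ← Complex.ofReal_add, ← Complex.ofReal_ofNat, ← Complex.ofReal_div]
  congr 1
  rw [neg_mul, ← sub_eq_add_neg] at h2 ⊢
  generalize |ξ| ^ (2 * s) = P at h1 h2 ⊢
  field_simp
  ring

theorem symbolK_zero_one (hs : s ∈ Set.Ioo (1 / 2 : ℝ) 1) (ha : 0 < a)
    (hb : |b| < critSpeed s a) (ξ : ℝ) : symbolK s a b ξ 0 1 = Complex.I *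
    ((1 / (|ξ| ^ (2 * s) + a + -b * ξ) : ℝ) - (1 / (|ξ| ^ (2 * s) + a + b * ξ) : ℝ) : ℂ) / 2 := by
  have h1 := factor_ne_zero hs ha hb ξ
  have h2 := factor_ne_zero hs ha ((abs_neg b).trans_lt hb) ξ
  rw [symbolK_eq]
  simp only [Matrix.of_apply, Matrix.cons_val_zero, Matrix.cons_val_one, lam]
  rw [mul_assoc, mul_div_assoc, mul_div_assoc Complex.I, ← Complex.ofReal_mul, ← Complex.ofReal_div,
    ← Complex.ofReal_sub, ← Complex.ofReal_ofNat, ← Complex.ofReal_div]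
  congr 2
  rw [neg_mul, ← sub_eq_add_neg] at h2 ⊢
  generalize |ξ| ^ (2 * s) = P at h1 h2 ⊢
  rw [div_sub_div _ _ h2 h1, div_div, div_eq_div_iff (mul_ne_zero h1 h2)
    (mul_ne_zero (mul_ne_zero h2 h1) two_ne_zero)]
  ring

theorem kernelC_zero_zero (hs : s ∈ Set.Ioo (1 / 2 : ℝ) 1) (ha : 0 < a)
    (hb : |b| < critSpeed s a) (x : ℝ) : kernelC s a b 0 0 x =
    (1 / (2 * Real.pi) : ℝ) * ((lineFourier s a b x + lineFourier s a (-b) x) / 2) := by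
  rw [kernelC, lineFourier, lineFourier, ← integral_add (integrable_lineFourier hs ha hb x)
    (integrable_lineFourier hs ha ((abs_neg b).trans_lt hb) x), ← integral_div]
  congr 1
  refine integral_congr_ae (Eventually.of_forall fun ξ => ?_)
  simp only [symbolK_zero_zero hs ha hb]
  ring

theorem kernelC_zero_one (hs : s ∈ Set.Ioo (1 / 2 : ℝ) 1) (ha : 0 < a)
    (hb : |b| < critSpeed s a) (x : ℝ) : kernelC s a b 0 1 x =
    (1 / (2 * Real.pi) : ℝ) *
      (Complex.I * (lineFourier s a (-b) x - lineFourier s a b x) / 2) := by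
  rw [kernelC]
  congr 1
  rw [lineFourier, lineFourier, ← integral_sub
    (integrable_lineFourier hs ha ((abs_neg b).trans_lt hb) x)
    (integrable_lineFourier hs ha hb x), mul_div_assoc, ← integral_div,
    ← integral_const_mul]
  refine integral_congr_ae (Eventually.of_forall fun ξ => ?_)
  simp only [symbolK_zero_one hs ha hb]
  ring

theorem kernel_one_one (x : ℝ) : kernel s a b 1 1 x = kernel s a b 0 0 x := by
  simp [kernel, kernelC, symbolK_eq]

theorem kernel_one_zero (x : ℝ) : kernel s a b 1 0 x = -kernel s a b 0 1 x := by
  simp [kernel, kernelC, symbolK_eq, integral_neg]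

theorem kernel_zero_zero_abs (hs : s ∈ Set.Ioo (1 / 2 : ℝ) 1) (ha : 0 < a)
    (hb : |b| < critSpeed s a) (x : ℝ) : kernel s a b 0 0 |x| = kernel s a b 0 0 x := by
  rcases abs_choice x with h | h <;> rw [h]
  rw [kernel, kernel, kernelC_zero_zero hs ha hb, kernelC_zero_zero hs ha hb, lineFourier_neg,
    lineFourier_neg, neg_neg, add_comm (lineFourier s a (-b) x)]

theorem abs_kernel_zero_one_abs (hs : s ∈ Set.Ioo (1 / 2 : ℝ) 1) (ha : 0 < a)
    (hb : |b| < critSpeed s a) (x : ℝ) : |kernel s a b 0 1 (|x|)| = |kernel s a b 0 1 x| := by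
  rcases abs_choice x with h | h <;> rw [h]
  rw [← abs_neg]
  congr 1
  rw [kernel, kernel, kernelC_zero_one hs ha hb, kernelC_zero_one hs ha hb, lineFourier_neg,
    lineFourier_neg, neg_neg, ← Complex.neg_re]
  congr 1; ring

theorem continuous_kernel (hs : s ∈ Set.Ioo (1 / 2 : ℝ) 1) (ha : 0 < a)
    (hb : |b| < critSpeed s a) (i j : Fin 2) : Continuous (kernel s a b i j) := by
  have h1 := continuous_lineFourier hs ha hb
  have h2 := continuous_lineFourier hs ha ((abs_neg b).trans_lt hb)
  have h00 : Continuous (kernel s a b 0 0) := by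
    unfold kernel
    simp only [kernelC_zero_zero hs ha hb]
    fun_prop
  have h01 : Continuous (kernel s a b 0 1) := by
    unfold kernel
    simp only [kernelC_zero_one hs ha hb]
    fun_prop
  fin_cases i <;> fin_cases j
  · exact h00
  · exact h01
  · exact h01.neg.congr fun x => (kernel_one_zero x).symm
  · exact h00.congr fun x => (kernel_one_one x).symm

/-- Taking real parts kills the `1/(ax)` terms, and the `±b/(a²x²)` terms cancel between the two
signs of `b`. -/
theorem kernel_zero_zero_eq (hs : s ∈ Set.Ioo (1 / 2 : ℝ) 1) (ha : 0 < a)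
    (hb : |b| < critSpeed s a) {x : ℝ} (hx : 0 < x) : kernel s a b 0 0 x =
    1 / (2 * Real.pi) * ((x ^ 3)⁻¹ *
      ((halfFourier₃ s a b x).im + (halfFourier₃ s a (-b) x).im)) := by
  have hb' := (abs_neg b).trans_lt hb
  rw [kernel, kernelC_zero_zero hs ha hb, lineFourier_eq hs ha hb, lineFourier_eq hs ha hb',
    neg_neg, halfFourier_eq hs ha hb hx, halfFourier_eq hs ha hb' hx, Complex.re_ofReal_mul]
  congr 1
  rw [← Complex.ofReal_ofNat, Complex.div_ofReal_re]
  simp only [Complex.add_re, Complex.sub_re, Complex.conj_re, Complex.mul_re, Complex.mul_im,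
    Complex.I_re, Complex.I_im, Complex.ofReal_re, Complex.ofReal_im]
  ring

/-- Here imaginary parts of the half-line integrals enter: the real `x⁻²` terms drop out and the
`1/(ax)` terms cancel in the difference. -/
theorem kernel_zero_one_eq (hs : s ∈ Set.Ioo (1 / 2 : ℝ) 1) (ha : 0 < a)
    (hb : |b| < critSpeed s a) {x : ℝ} (hx : 0 < x) : kernel s a b 0 1 x =
    1 / (2 * Real.pi) * ((x ^ 3)⁻¹ *
      ((halfFourier₃ s a (-b) x).re - (halfFourier₃ s a b x).re)) := by
  have hb' := (abs_neg b).trans_lt hb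
  rw [kernel, kernelC_zero_one hs ha hb, lineFourier_eq hs ha hb, lineFourier_eq hs ha hb',
    neg_neg, halfFourier_eq hs ha hb hx, halfFourier_eq hs ha hb' hx, Complex.re_ofReal_mul]
  congr 1
  rw [← Complex.ofReal_ofNat, Complex.div_ofReal_re]
  simp only [Complex.add_re, Complex.sub_re, Complex.conj_re, Complex.mul_re, Complex.mul_im,
    Complex.I_re, Complex.I_im, Complex.ofReal_re, Complex.ofReal_im, Complex.add_im,
    Complex.sub_im, Complex.conj_im]
  ring

theorem rpow_two_mul_add_one_mul_inv {x : ℝ} (hx : 0 < x) :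
    x ^ (2 * s + 1) * (x ^ 3)⁻¹ = x ^ (2 * s - 2) := by
  rw [← Real.rpow_natCast, ← Real.rpow_neg hx.le, ← Real.rpow_add hx]
  congr 1; push_cast; ring

theorem tendsto_kernel_zero_zero (hs : s ∈ Set.Ioo (1 / 2 : ℝ) 1) (ha : 0 < a)
    (hb : |b| < critSpeed s a) :
    Tendsto (fun x : ℝ => |x| ^ (2 * s + 1) * kernel s a b 0 0 x) (cocompact ℝ)
      (𝓝 (K₁ s a)) := by
  have hb' := (abs_neg b).trans_lt hb
  have t1 := (Complex.continuous_im.tendsto _).comp (tendsto_rpow_mul_halfFourier₃ hs ha hb)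
  have t2 := (Complex.continuous_im.tendsto _).comp (tendsto_rpow_mul_halfFourier₃ hs ha hb')
  have h := ((t1.add t2).const_mul (1 / (2 * Real.pi))).comp
    (tendsto_norm_cocompact_atTop (E := ℝ))
  have hK : 1 / (2 * Real.pi) * ((limitConst s a).im + (limitConst s a).im) = K₁ s a := by
    rw [im_limitConst hs ha]
    have := Real.pi_ne_zero
    field_simp; ring
  rw [hK] at h
  refine h.congr' ?_
  filter_upwards [(tendsto_norm_cocompact_atTop (E := ℝ)).eventually (eventually_gt_atTop 0)]
    with x hx
  have hx' : 0 < |x| := hx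
  rw [← kernel_zero_zero_abs hs ha hb, kernel_zero_zero_eq hs ha hb hx']
  simp only [Function.comp_apply, Complex.im_ofReal_mul, Real.norm_eq_abs]
  rw [← rpow_two_mul_add_one_mul_inv hx']
  ring

theorem tendsto_kernel_zero_one (hs : s ∈ Set.Ioo (1 / 2 : ℝ) 1) (ha : 0 < a)
    (hb : |b| < critSpeed s a) :
    Tendsto (fun x : ℝ => |x| ^ (2 * s + 1) * kernel s a b 0 1 x) (cocompact ℝ) (𝓝 0) := by
  have hb' := (abs_neg b).trans_lt hb
  have t1 := (Complex.continuous_re.tendsto _).comp (tendsto_rpow_mul_halfFourier₃ hs ha hb)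
  have t2 := (Complex.continuous_re.tendsto _).comp (tendsto_rpow_mul_halfFourier₃ hs ha hb')
  have h := ((t2.sub t1).const_mul (1 / (2 * Real.pi))).abs.comp
    (tendsto_norm_cocompact_atTop (E := ℝ))
  rw [sub_self, mul_zero, abs_zero] at h
  refine (tendsto_zero_iff_abs_tendsto_zero _).2 (h.congr' ?_)
  filter_upwards [(tendsto_norm_cocompact_atTop (E := ℝ)).eventually (eventually_gt_atTop 0)]
    with x hx
  have hx' : 0 < |x| := hx
  simp only [Function.comp_apply]
  rw [abs_mul (|x| ^ (2 * s + 1)), ← abs_kernel_zero_one_abs hs ha hb, ← abs_mul (|x| ^ (2 * s + 1)),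
    kernel_zero_one_eq hs ha hb hx']
  simp only [Complex.re_ofReal_mul, Real.norm_eq_abs]
  rw [← rpow_two_mul_add_one_mul_inv hx']
  congr 1
  ring

end Kernel

/-- A continuous function with the tail `|x| ^ (-α)` is dominated by `(1 + |x|) ^ (-α)`. -/
theorem exists_abs_le_of_tendsto {k : ℝ → ℝ} {α κ : ℝ} (hα : 0 ≤ α) (hk : Continuous k)
    (h : Tendsto (fun x : ℝ => |x| ^ α * k x) (cocompact ℝ) (𝓝 κ)) :
    ∃ C, ∀ x, |k x| ≤ C * (1 + |x|) ^ (-α) := by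
  have h1 : ∀ᶠ x in cocompact ℝ, |(|x| ^ α * k x)| < |κ| + 1 :=
    h.abs.eventually (gt_mem_nhds (by linarith))
  -- Outside the compact set `S` also `|x| ≥ 1`, so `1 + |x| ≤ 2|x|`; this is the origin of the
  -- factor `2 ^ α`.
  obtain ⟨S, hS, hS'⟩ := mem_cocompact.1 ((h1.and
    ((tendsto_norm_cocompact_atTop (E := ℝ)).eventually (eventually_ge_atTop 1))))
  obtain ⟨M, hM⟩ := hS.exists_bound_of_continuousOn
    (f := fun x => (1 + |x|) ^ α * k x)
    ((Continuous.rpow_const (by fun_prop) fun x => Or.inr hα).mul hk).continuousOn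
  refine ⟨max M (2 ^ α * (|κ| + 1)), fun x => ?_⟩
  have hp : 0 < (1 + |x|) ^ α := by positivity
  rw [Real.rpow_neg (by positivity), ← div_eq_mul_inv, le_div_iff₀ hp]
  by_cases hx : x ∈ S
  · refine le_trans ?_ (le_max_left _ _)
    have := hM x hx
    rwa [Real.norm_eq_abs, abs_mul, abs_of_pos hp, mul_comm] at this
  · refine le_trans ?_ (le_max_right _ _)
    obtain ⟨h2, h3⟩ := hS' hx
    simp only [Real.norm_eq_abs] at h3
    rw [abs_mul, abs_of_nonneg (by positivity)] at h2
    calc |k x| * (1 + |x|) ^ α ≤ |k x| * (2 * |x|) ^ α := by gcongr; linarith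
      _ = 2 ^ α * (|x| ^ α * |k x|) := by
          rw [Real.mul_rpow (by norm_num) (abs_nonneg x)]; ring
      _ ≤ _ := by gcongr

/-! ### Convolution with polynomially decaying kernels -/

/-- The weight `(1 + |x|) ^ (-α)`. -/
def weight (α x : ℝ) : ℝ := (1 + |x|) ^ (-α)

theorem weight_pos (α x : ℝ) : 0 < weight α x := by
  rw [weight]; positivity

theorem continuous_weight (α : ℝ) : Continuous (weight α) :=
  Continuous.rpow_const (by fun_prop) fun x => Or.inl (by positivity)

theorem integrable_weight {α : ℝ} (hα : 1 < α) : Integrable (weight α) := by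
  simpa [weight] using! integrable_one_add_norm (E := ℝ) (μ := volume) (r := α) (by simpa using hα)

theorem weight_le {α C r x : ℝ} (hα : 0 ≤ α) (hr : 0 < r) (hC : 0 < C) (h : r ≤ C * (1 + |x|)) :
    weight α x ≤ C ^ α * r ^ (-α) := by
  have h1 : r / C ≤ 1 + |x| := by rw [div_le_iff₀ hC]; linarith
  refine (Real.rpow_le_rpow_of_nonpos (by positivity) h1 (by linarith)).trans_eq ?_
  rw [Real.div_rpow hr.le hC.le, Real.rpow_neg hC.le, div_inv_eq_mul, mul_comm]

/-- The larger of `|x - y|` and `|y|` is at least `|x|/2`, so its weight is at most `2 ^ α * weight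
α x`. Hence the weight is stable under convolution with itself. -/
theorem weight_mul_weight_le {α : ℝ} (hα : 0 ≤ α) (x y : ℝ) :
    weight α (x - y) * weight α y ≤ 2 ^ α * weight α x * (weight α (x - y) + weight α y) := by
  have h1 := weight_pos α (x - y)
  have h2 := weight_pos α y
  have h3 : |x| ≤ |x - y| + |y| := by simpa using abs_add_le (x - y) y
  have hx : 0 < 1 + |x| := by positivity
  have hk : 0 ≤ 2 ^ α * weight α x := mul_nonneg (by positivity) (weight_pos α x).le
  rcases le_total |x - y| |y| with h | h
  · have : weight α y ≤ 2 ^ α * weight α x := weight_le hα hx two_pos (by linarith)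
    nlinarith
  · have : weight α (x - y) ≤ 2 ^ α * weight α x := weight_le hα hx two_pos (by linarith)
    nlinarith

theorem integral_weight_sub (α x : ℝ) : ∫ y, weight α (x - y) = ∫ y, weight α y :=
  integral_sub_left_eq_self (weight α) volume x

theorem integrable_weight_sub {α : ℝ} (hα : 1 < α) (x : ℝ) :
    Integrable fun y => weight α (x - y) :=
  (integrable_weight hα).comp_sub_left x

theorem integrable_weight_sub_mul_weight {α : ℝ} (hα : 1 < α) (x : ℝ) :
    Integrable fun y => weight α (x - y) * weight α y := by
  have hc := continuous_weight α
  refine Integrable.mono' (((integrable_weight_sub hα x).add (integrable_weight hα)).const_mul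
    (2 ^ α * weight α x)) (by fun_prop : Continuous _).aestronglyMeasurable
    (Eventually.of_forall fun y => ?_)
  rw [Real.norm_eq_abs, abs_of_pos (mul_pos (weight_pos _ _) (weight_pos _ _))]
  exact weight_mul_weight_le (by linarith) x y

theorem integral_weight_sub_mul_weight_le {α : ℝ} (hα : 1 < α) (x : ℝ) :
    ∫ y, weight α (x - y) * weight α y ≤ 2 ^ α * 2 * (∫ y, weight α y) * weight α x := by
  have h := integral_mono (integrable_weight_sub_mul_weight hα x)
    (((integrable_weight_sub hα x).add (integrable_weight hα)).const_mul (2 ^ α * weight α x))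
    fun y => weight_mul_weight_le (by linarith) x y
  refine h.trans_eq ?_
  rw [integral_const_mul]
  simp only [Pi.add_apply]
  rw [integral_add (integrable_weight_sub hα x) (integrable_weight hα), integral_weight_sub]
  ring

/-- A bounded function that is controlled by a convolution of itself with a polynomially decaying
kernel, up to a factor that is small at infinity, inherits the decay of the kernel. -/
theorem exists_le_weight_of_le_convolution {α K N M : ℝ} {u H : ℝ → ℝ} (hα : 1 < α) (hK : 0 ≤ K)
    (hu0 : ∀ x, 0 ≤ u x) (hH0 : ∀ x, 0 ≤ H x) (hu : ∀ᵐ x, u x ≤ N) (hH : ∀ᵐ x, H x ≤ M)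
    (hsmall : ∀ ε > 0, ∃ R, ∀ᵐ y, R < |y| → H y ≤ ε * u y)
    (hconv : ∀ᵐ x, u x ≤ K * ∫ y, weight α (x - y) * H y) :
    ∃ B ≥ 0, ∀ᵐ x, u x ≤ B * weight α x := by
  have hα0 : 0 ≤ α := by linarith
  set I := ∫ y, weight α y with hI
  have hI0 : 0 ≤ I := integral_nonneg fun y => (weight_pos α y).le
  set C := (2 ^ α * 2 + 1) * I with hC
  have hC0 : 0 ≤ C := by positivity
  have hN0 : 0 ≤ N := by obtain ⟨x, hx⟩ := hu.exists; exact (hu0 x).trans hx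
  have hM0 : 0 ≤ M := by obtain ⟨x, hx⟩ := hH.exists; exact (hH0 x).trans hx
  have hKC : 0 ≤ K * C := mul_nonneg hK hC0
  -- Chosen so that the part of `H` proportional to `u` contributes a factor at most `1/2` after
  -- convolution.
  set ε := 1 / (2 * (K * C + 1)) with hε
  have hε0 : 0 < ε := by positivity
  have hKCε : K * C * ε ≤ 1 / 2 := by
    rw [hε, mul_one_div, div_le_iff₀ (by positivity)]; linarith
  obtain ⟨R, hR⟩ := hsmall ε hε0
  set M' := M * (1 + max R 0) ^ α with hM'
  have hM'0 : 0 ≤ M' := by positivity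
  have hHu : ∀ᵐ y, H y ≤ M' * weight α y + ε * u y := by
    filter_upwards [hH, hR] with y h1 h2
    have hw := weight_pos α y
    have huy := hu0 y
    rcases lt_or_ge R |y| with h | h
    · have := h2 h
      have : 0 ≤ M' * weight α y := by positivity
      linarith
    · have h3 : 1 ≤ (1 + max R 0) ^ α * weight α y := by
        rw [weight, Real.rpow_neg (by positivity), ← div_eq_mul_inv, one_le_div (by positivity)]
        gcongr
        exact h.trans (le_max_left _ _)
      have h4 : M * 1 ≤ M * ((1 + max R 0) ^ α * weight α y) := by gcongr
      have h5 : 0 ≤ ε * u y := by positivity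
      rw [hM']; linarith
  set B := K * C * M' with hB
  have hB0 : 0 ≤ B := by positivity
  -- The added `δ` allows the iteration to start: `u` is known only to be bounded, so it has no a
  -- priori bound by a multiple of `weight α`. Convolution with the weight maps `weight α + δ` below
  -- `C (weight α + δ)`, with `C` independent of `δ`.
  have hstep : ∀ δ > 0, ∀ A ≥ 0, (∀ᵐ x, u x ≤ A * (weight α x + δ)) →
      ∀ᵐ x, u x ≤ (B + A / 2) * (weight α x + δ) := by
    intro δ hδ A hA h
    have hH' : ∀ᵐ y, H y ≤ (M' + ε * A) * (weight α y + δ) := by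
      filter_upwards [hHu, h] with y h1 h2
      have h3 : ε * u y ≤ ε * (A * (weight α y + δ)) := by gcongr
      nlinarith [mul_nonneg hM'0 hδ.le]
    filter_upwards [hconv] with x hx
    have hw := weight_pos α x
    have hi : Integrable fun y => (M' + ε * A) *
        (weight α (x - y) * weight α y + δ * weight α (x - y)) :=
      ((integrable_weight_sub_mul_weight hα x).add
        ((integrable_weight_sub hα x).const_mul δ)).const_mul _
    have h1 : ∫ y, weight α (x - y) * H y ≤ ∫ y, (M' + ε * A) *
        (weight α (x - y) * weight α y + δ * weight α (x - y)) := by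
      refine integral_mono_of_nonneg (Eventually.of_forall fun y =>
        mul_nonneg (weight_pos _ _).le (hH0 y)) hi ?_
      filter_upwards [hH'] with y hy
      calc weight α (x - y) * H y
          ≤ weight α (x - y) * ((M' + ε * A) * (weight α y + δ)) :=
            mul_le_mul_of_nonneg_left hy (weight_pos _ _).le
        _ = _ := by ring
    rw [integral_const_mul, integral_add (integrable_weight_sub_mul_weight hα x)
      ((integrable_weight_sub hα x).const_mul δ), integral_const_mul, integral_weight_sub,
      ← hI] at h1
    have h2 := integral_weight_sub_mul_weight_le hα x
    rw [← hI] at h2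
    have h3 : ∫ y, weight α (x - y) * H y ≤ (M' + ε * A) * (C * (weight α x + δ)) := by
      refine h1.trans (mul_le_mul_of_nonneg_left ?_ (by positivity))
      have h4 : 0 ≤ I * weight α x + 2 ^ α * 2 * I * δ := by positivity
      rw [hC]; linarith
    calc u x ≤ K * ∫ y, weight α (x - y) * H y := hx
      _ ≤ K * ((M' + ε * A) * (C * (weight α x + δ))) := by gcongr
      _ = (B + K * C * ε * A) * (weight α x + δ) := by rw [hB]; ring
      _ ≤ (B + A / 2) * (weight α x + δ) := by
          gcongr
          calc K * C * ε * A ≤ 1 / 2 * A := by gcongr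
            _ = A / 2 := by ring
  -- The start is `u ≤ N = (N/δ) δ`. The map `A ↦ B + A/2` has the fixed point `2B`, which does not
  -- depend on `δ`.
  have hiter : ∀ δ > 0, ∀ n : ℕ,
      ∀ᵐ x, u x ≤ (2 * B + N / δ * (1 / 2) ^ n) * (weight α x + δ) := by
    intro δ hδ n
    induction n with
    | zero =>
      filter_upwards [hu] with x hx
      have hw := weight_pos α x
      calc u x ≤ N / δ * δ := by rwa [div_mul_cancel₀ _ hδ.ne']
        _ ≤ _ := by
          rw [pow_zero, mul_one]
          gcongr <;> linarith
    | succ n ih =>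
      filter_upwards [hstep δ hδ _ (by positivity) ih] with x hx
      refine hx.trans_eq ?_
      ring
  -- Sending `δ` to `0` along `1/(n+1)` keeps the number of exceptional null sets countable.
  have hδ : ∀ n : ℕ, ∀ᵐ x, u x ≤ 2 * B * (weight α x + 1 / ((n : ℝ) + 1)) := by
    intro n
    have hn : (0 : ℝ) < 1 / ((n : ℝ) + 1) := by positivity
    filter_upwards [ae_all_iff.2 (hiter _ hn)] with x hx
    have hp : Tendsto (fun m : ℕ => (1 / 2 : ℝ) ^ m) atTop (𝓝 0) :=
      tendsto_pow_atTop_nhds_zero_of_lt_one (by norm_num) (by norm_num)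
    have h := ((hp.const_mul (N / (1 / ((n : ℝ) + 1)))).const_add (2 * B)).mul_const
      (weight α x + 1 / ((n : ℝ) + 1))
    rw [mul_zero, add_zero] at h
    exact ge_of_tendsto' h hx
  refine ⟨2 * B, by positivity, ?_⟩
  filter_upwards [ae_all_iff.2 hδ] with x hx
  have h := ((tendsto_one_div_add_atTop_nhds_zero_nat (𝕜 := ℝ)).const_add (weight α x)).const_mul
    (2 * B)
  rw [add_zero] at h
  exact ge_of_tendsto' h hx

/-- The tail of a convolution with a kernel that has the tail `κ |x| ^ (-α)`. -/
theorem tendsto_rpow_mul_convolution {α γ κ C C' : ℝ} {k g : ℝ → ℝ} (hα : 1 < α) (hγ : α < γ)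
    (hk : Continuous k) (hkC : ∀ x, |k x| ≤ C * weight α x)
    (hκ : Tendsto (fun x : ℝ => |x| ^ α * k x) (cocompact ℝ) (𝓝 κ))
    (hg : AEStronglyMeasurable g) (hgC : ∀ᵐ y, |g y| ≤ C' * weight γ y) :
    Tendsto (fun x : ℝ => |x| ^ α * ∫ y, k (x - y) * g y) (cocompact ℝ) (𝓝 (κ * ∫ y, g y)) := by
  have hα0 : 0 ≤ α := by linarith
  have hC0 : 0 ≤ C := by
    have := (abs_nonneg _).trans (hkC 0)
    exact nonneg_of_mul_nonneg_left this (weight_pos _ _)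
  have hC'0 : 0 ≤ C' := by
    obtain ⟨y, hy⟩ := hgC.exists
    exact nonneg_of_mul_nonneg_left ((abs_nonneg _).trans hy) (weight_pos _ _)
  have hw1 : ∀ x, weight α x ≤ 1 := fun x =>
    Real.rpow_le_one_of_one_le_of_nonpos (by linarith [abs_nonneg x]) (by linarith)
  have hwg : Integrable fun y => C' * weight γ y := (integrable_weight (hα.trans hγ)).const_mul C'
  have hmeas : ∀ x : ℝ, AEStronglyMeasurable (fun y => |x| ^ α * (k (x - y) * g y)) := fun x =>
    (((hk.comp (by fun_prop : Continuous fun y => x - y)).aestronglyMeasurable).mul hg).const_mul _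
  have hi : ∀ x : ℝ, Integrable fun y => |x| ^ α * (k (x - y) * g y) := by
    intro x
    refine Integrable.mono' (hwg.const_mul (|x| ^ α * C)) (hmeas x) ?_
    filter_upwards [hgC] with y hy
    rw [norm_mul, norm_mul, Real.norm_eq_abs, Real.norm_eq_abs, Real.norm_eq_abs,
      abs_of_nonneg (by positivity : 0 ≤ |x| ^ α), mul_assoc]
    have : |k (x - y)| ≤ C := (hkC _).trans (mul_le_of_le_one_right hC0 (hw1 _))
    gcongr
  have : (cocompact ℝ).IsCountablyGenerated := by
    rw [← Metric.cobounded_eq_cocompact, ← comap_norm_atTop]; infer_instance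
  set S : ℝ → Set ℝ := fun x => {y | |y| ≤ |x| / 2} with hS
  have hSm : ∀ x, MeasurableSet (S x) := fun x => measurableSet_le (by fun_prop) (by fun_prop)
  -- On `|y| ≤ |x|/2` one has `|x| ≤ 2|x - y|`, so `|x|^α |k(x - y)|` is bounded by `2^α C` and
  -- dominated convergence applies.
  have hnear : Tendsto (fun x : ℝ => ∫ y, (S x).indicator
      (fun y => |x| ^ α * (k (x - y) * g y)) y) (cocompact ℝ) (𝓝 (∫ y, κ * g y)) := by
    refine tendsto_integral_filter_of_dominated_convergence (fun y => 2 ^ α * C * (C' * weight γ y))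
      (Eventually.of_forall fun x => (hmeas x).indicator (hSm x))
      (Eventually.of_forall fun x => ?_) (hwg.const_mul _) (Eventually.of_forall fun y => ?_)
    · filter_upwards [hgC] with y hy
      have h0 : 0 ≤ 2 ^ α * C * (C' * weight γ y) := by
        have := (weight_pos γ y).le
        positivity
      by_cases hxy : y ∈ S x
      · rw [Set.indicator_of_mem hxy, norm_mul, norm_mul, Real.norm_eq_abs, Real.norm_eq_abs,
          Real.norm_eq_abs, abs_of_nonneg (by positivity : 0 ≤ |x| ^ α), ← mul_assoc]
        have hxy' : |y| ≤ |x| / 2 := hxy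
        have h3 : |x| ≤ |x - y| + |y| := by simpa using abs_add_le (x - y) y
        have h4 : |x| ^ α * |k (x - y)| ≤ 2 ^ α * C := by
          calc |x| ^ α * |k (x - y)| ≤ (2 * (1 + |x - y|)) ^ α * (C * weight α (x - y)) := by
                gcongr
                · linarith
                · exact hkC _
            _ = 2 ^ α * C := by
                rw [Real.mul_rpow (by norm_num) (by positivity), weight,
                  Real.rpow_neg (by positivity)]
                field_simp
        gcongr
      · rw [Set.indicator_of_notMem hxy, norm_zero]; exact h0
    · have hsub : Tendsto (fun x : ℝ => x - y) (cocompact ℝ) (cocompact ℝ) :=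
        (Homeomorph.subRight y).isClosedEmbedding.tendsto_cocompact
      have h1 := hκ.comp hsub
      have h2 : Tendsto (fun x : ℝ => |1 + y * (x - y)⁻¹| ^ α) (cocompact ℝ) (𝓝 1) := by
        have h3 : Tendsto (fun x : ℝ => (x - y)⁻¹) (cocompact ℝ) (𝓝 0) := by
          rw [← Metric.cobounded_eq_cocompact] at hsub ⊢
          exact tendsto_inv₀_cobounded.comp hsub
        have h4 := (((h3.const_mul y).const_add 1).abs).rpow_const (p := α) (Or.inr hα0)
        simpa using h4
      have h5 := (h2.mul h1).mul_const (g y)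
      rw [one_mul] at h5
      refine h5.congr' ?_
      filter_upwards [(tendsto_norm_cocompact_atTop (E := ℝ)).eventually
        (eventually_gt_atTop (2 * |y|))] with x hx
      rw [Real.norm_eq_abs] at hx
      have hxy : y ∈ S x := by
        change |y| ≤ |x| / 2
        linarith
      have hne : x - y ≠ 0 := by
        intro h
        rw [sub_eq_zero.1 h] at hx
        linarith [abs_nonneg y]
      rw [Set.indicator_of_mem hxy]
      have h6 : |x| = |1 + y * (x - y)⁻¹| * |x - y| := by
        rw [← abs_mul]; congr 1; field_simp; ring
      rw [h6, Real.mul_rpow (abs_nonneg _) (abs_nonneg _)]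
      simp only [Function.comp_apply]
      ring
  -- On `|y| > |x|/2` the decay of `g` absorbs `|x|^α` and still leaves `|x|^(-(γ-α))`, which tends
  -- to `0`; integrability in `y` comes from the kernel.
  have hfar : Tendsto (fun x : ℝ => ∫ y, (S x)ᶜ.indicator
      (fun y => |x| ^ α * (k (x - y) * g y)) y) (cocompact ℝ) (𝓝 0) := by
    have h1 : Tendsto (fun x : ℝ => 2 ^ α * C * C' * (2 ^ (γ - α) * |x| ^ (-(γ - α))) *
        ∫ y, weight α y) (cocompact ℝ) (𝓝 0) := by
      have h2 := (tendsto_rpow_neg_atTop (y := γ - α) (by linarith)).comp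
        (tendsto_norm_cocompact_atTop (E := ℝ))
      have h3 := ((h2.const_mul (2 ^ (γ - α))).const_mul (2 ^ α * C * C')).mul_const
        (∫ y, weight α y)
      simpa using! h3
    refine squeeze_zero_norm' ?_ h1
    filter_upwards [(tendsto_norm_cocompact_atTop (E := ℝ)).eventually
      (eventually_gt_atTop 0)] with x hx
    rw [Real.norm_eq_abs] at hx
    rw [← integral_weight_sub α x, ← integral_const_mul]
    refine norm_integral_le_of_norm_le ((integrable_weight_sub hα x).const_mul _) ?_
    filter_upwards [hgC] with y hy
    have hwx := (weight_pos α (x - y)).le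
    by_cases hxy : y ∈ S x
    · rw [Set.indicator_of_notMem (by simpa using hxy), norm_zero]
      positivity
    · rw [Set.indicator_of_mem (by simpa using hxy), norm_mul, norm_mul, Real.norm_eq_abs,
        Real.norm_eq_abs, Real.norm_eq_abs, abs_of_nonneg (by positivity : 0 ≤ |x| ^ α)]
      have hxy' : |x| / 2 < |y| := not_le.1 hxy
      have hwγ : weight γ y = (1 + |y|) ^ (-α) * weight (γ - α) y := by
        rw [weight, weight, ← Real.rpow_add (by positivity)]; congr 1; ring
      have h7 : weight (γ - α) y ≤ 2 ^ (γ - α) * |x| ^ (-(γ - α)) :=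
        weight_le (by linarith) hx two_pos (by linarith)
      calc |x| ^ α * (|k (x - y)| * |g y|)
          ≤ (2 * (1 + |y|)) ^ α * ((C * weight α (x - y)) * (C' * weight γ y)) := by
            gcongr
            · linarith
            · exact hkC _
        _ = 2 ^ α * C * C' * weight (γ - α) y * weight α (x - y) := by
            rw [hwγ, Real.mul_rpow (by norm_num) (by positivity), Real.rpow_neg (by positivity)]
            field_simp
        _ ≤ _ := by gcongr
  have h := hnear.add hfar
  rw [add_zero, integral_const_mul] at h
  refine h.congr fun x => ?_
  rw [integral_indicator (hSm x), integral_indicator (hSm x).compl,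
    integral_add_compl (hSm x) (hi x), integral_const_mul]

/-! ### The convolution system -/

theorem eventually_essInfty {p : ℝ → Prop} (h : ∀ᶠ x in essInfty, p x) :
    ∃ R, ∀ᵐ x, R < |x| → p x := by
  obtain ⟨S, hS, T, hT, hST⟩ := mem_inf_iff_superset.1 h
  obtain ⟨t, ht, htS⟩ := mem_cocompact.1 hS
  obtain ⟨R, hR⟩ := ht.isBounded.subset_closedBall 0
  refine ⟨R, ?_⟩
  filter_upwards [hT] with x hx hxR
  refine hST ⟨htS fun hxt => ?_, hx⟩
  have := hR hxt
  rw [mem_closedBall_zero_iff, Real.norm_eq_abs] at this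
  linarith

theorem exists_ae_abs_le {v : ℝ → ℝ} (hv : MemLp v ⊤ volume) : ∃ N, 0 ≤ N ∧ ∀ᵐ x, |v x| ≤ N := by
  refine ⟨(eLpNormEssSup v volume).toReal, ENNReal.toReal_nonneg, ?_⟩
  have hfin : eLpNormEssSup v volume ≠ ⊤ := by
    have := hv.2
    rw [eLpNorm_exponent_top] at this
    exact this.ne
  filter_upwards [ae_le_eLpNormEssSup (f := v) (μ := volume)] with x hx
  have := ENNReal.toReal_mono hfin hx
  simpa using this

theorem integrable_kernel_sub_mul {α C : ℝ} {k g : ℝ → ℝ} (hα : 0 ≤ α) (hk : Continuous k)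
    (hkC : ∀ x, |k x| ≤ C * weight α x) (hg : Integrable g) (x : ℝ) :
    Integrable fun y => k (x - y) * g y := by
  have hC0 : 0 ≤ C := nonneg_of_mul_nonneg_left ((abs_nonneg _).trans (hkC 0)) (weight_pos _ _)
  refine Integrable.mono' (hg.norm.const_mul C) (((hk.comp (by fun_prop : Continuous fun y =>
    x - y)).aestronglyMeasurable).mul hg.1) (Eventually.of_forall fun y => ?_)
  rw [norm_mul, Real.norm_eq_abs]
  have : |k (x - y)| ≤ C := (hkC _).trans (mul_le_of_le_one_right hC0
    (Real.rpow_le_one_of_one_le_of_nonpos (by linarith [abs_nonneg (x - y)]) (by linarith)))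
  gcongr

theorem abs_g₁_add_abs_g₂ (σ v w : ℝ) :
    |g₁ σ v w| + |g₂ σ v w| = (v ^ 2 + w ^ 2) ^ σ * (|v| + |w|) := by
  rw [g₁, g₂, abs_mul, abs_mul, abs_of_nonneg (by positivity : 0 ≤ (v ^ 2 + w ^ 2) ^ σ)]
  ring

/-- The exponent `2σ + 1 > 1` is the gain: a decay rate `α` of the solution becomes `α(2σ + 1)` for
the nonlinearity. -/
theorem abs_g₁_add_abs_g₂_le {σ v w : ℝ} (hσ : 0 < σ) :
    |g₁ σ v w| + |g₂ σ v w| ≤ (|v| + |w|) ^ (2 * σ + 1) := by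
  rw [abs_g₁_add_abs_g₂, Real.rpow_add_one' (by positivity) (by positivity),
    Real.rpow_mul (by positivity), Real.rpow_two]
  gcongr
  nlinarith [abs_nonneg v, abs_nonneg w, sq_abs v, sq_abs w]

theorem abs_integral_le_of_abs_le_weight {α C x : ℝ} {p q g h : ℝ → ℝ}
    (hp : ∀ x, |p x| ≤ C * weight α x) (hq : ∀ x, |q x| ≤ C * weight α x)
    (hi : Integrable fun y => weight α (x - y) * (|g y| + |h y|)) :
    |∫ y, (p (x - y) * g y + q (x - y) * h y)| ≤
      C * ∫ y, weight α (x - y) * (|g y| + |h y|) := by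
  rw [← integral_const_mul, ← Real.norm_eq_abs]
  refine norm_integral_le_of_norm_le (hi.const_mul C) (Eventually.of_forall fun y => ?_)
  rw [Real.norm_eq_abs]
  refine (abs_add_le _ _).trans ?_
  rw [abs_mul, abs_mul]
  have h1 := mul_le_mul_of_nonneg_right (hp (x - y)) (abs_nonneg (g y))
  have h2 := mul_le_mul_of_nonneg_right (hq (x - y)) (abs_nonneg (h y))
  linarith

theorem tendsto_rpow_mul_convolution_add {α γ κ C C' : ℝ} {p q g h : ℝ → ℝ} (hα : 1 < α)
    (hγ : α < γ) (hp : Continuous p) (hq : Continuous q) (hpC : ∀ x, |p x| ≤ C * weight α x)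
    (hqC : ∀ x, |q x| ≤ C * weight α x)
    (hpκ : Tendsto (fun x : ℝ => |x| ^ α * p x) (cocompact ℝ) (𝓝 κ))
    (hq0 : Tendsto (fun x : ℝ => |x| ^ α * q x) (cocompact ℝ) (𝓝 0))
    (hg : Integrable g) (hh : Integrable h)
    (hgC : ∀ᵐ y, |g y| ≤ C' * weight γ y) (hhC : ∀ᵐ y, |h y| ≤ C' * weight γ y) :
    Tendsto (fun x : ℝ => |x| ^ α * ∫ y, (p (x - y) * g y + q (x - y) * h y)) (cocompact ℝ)
      (𝓝 (κ * ∫ y, g y)) := by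
  have h1 := (tendsto_rpow_mul_convolution hα hγ hp hpC hpκ hg.1 hgC).add
    (tendsto_rpow_mul_convolution hα hγ hq hqC hq0 hh.1 hhC)
  rw [zero_mul, add_zero] at h1
  refine h1.congr fun x => ?_
  rw [integral_add (integrable_kernel_sub_mul (by linarith) hp hpC hg x)
    (integrable_kernel_sub_mul (by linarith) hq hqC hh x), mul_add]

end FNLS

end

/-! ### Decay of solutions and their exact tails -/

theorem theorem3p2 (s a b σ : ℝ) (hs : s ∈ Set.Ioo (1 / 2 : ℝ) 1) (ha : 0 < a)
    (hb : |b| < FNLS.critSpeed s a) (hσ : 0 < σ) :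
    Tendsto (fun x : ℝ => |x| ^ (2 * s + 1) * FNLS.kernel s a b 0 0 x) (cocompact ℝ)
      (𝓝 (FNLS.K₁ s a)) ∧
    ∀ v w : ℝ → ℝ, MemLp v ⊤ volume → MemLp w ⊤ volume →
      (∀ᵐ x ∂volume, FNLS.SolvesAt s a b σ v w x) →
      Tendsto v FNLS.essInfty (𝓝 0) → Tendsto w FNLS.essInfty (𝓝 0) →
      Integrable (fun y => FNLS.g₁ σ (v y) (w y)) volume ∧
      Integrable (fun y => FNLS.g₂ σ (v y) (w y)) volume ∧
      Tendsto (fun x => |x| ^ (2 * s + 1) * v x) FNLS.essInfty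
        (𝓝 (FNLS.K₁ s a * ∫ y, FNLS.g₁ σ (v y) (w y))) ∧
      Tendsto (fun x => |x| ^ (2 * s + 1) * w x) FNLS.essInfty
        (𝓝 (FNLS.K₁ s a * ∫ y, FNLS.g₂ σ (v y) (w y))) ∧
      ((∀ x, FNLS.SolvesAt s a b σ v w x) →
        Tendsto (fun x => |x| ^ (2 * s + 1) * v x) (cocompact ℝ)
          (𝓝 (FNLS.K₁ s a * ∫ y, FNLS.g₁ σ (v y) (w y))) ∧
        Tendsto (fun x => |x| ^ (2 * s + 1) * w x) (cocompact ℝ)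
          (𝓝 (FNLS.K₁ s a * ∫ y, FNLS.g₂ σ (v y) (w y)))) ∧
      ∃ C : ℝ, ∀ᵐ x ∂volume, |x| ^ (2 * s + 1) * Real.sqrt (v x ^ 2 + w x ^ 2) ≤ C := by
  have hα : 1 < 2 * s + 1 := by linarith [hs.1]
  have hα0 : 0 ≤ 2 * s + 1 := by linarith
  have h00 := FNLS.tendsto_kernel_zero_zero hs ha hb
  have h01 := FNLS.tendsto_kernel_zero_one hs ha hb
  refine ⟨h00, fun v w hv hw hsol hv0 hw0 => ?_⟩
  have c00 := FNLS.continuous_kernel hs ha hb 0 0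
  have c01 := FNLS.continuous_kernel hs ha hb 0 1
  have c10 := FNLS.continuous_kernel hs ha hb 1 0
  have c11 := FNLS.continuous_kernel hs ha hb 1 1
  have h11 : Tendsto (fun x : ℝ => |x| ^ (2 * s + 1) * FNLS.kernel s a b 1 1 x) (cocompact ℝ)
      (𝓝 (FNLS.K₁ s a)) := h00.congr fun x => by rw [FNLS.kernel_one_one]
  have h10 : Tendsto (fun x : ℝ => |x| ^ (2 * s + 1) * FNLS.kernel s a b 1 0 x) (cocompact ℝ)
      (𝓝 0) := by
    have := h01.neg
    rw [neg_zero] at this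
    exact this.congr fun x => by rw [FNLS.kernel_one_zero, mul_neg]
  obtain ⟨C₀, hC₀⟩ := FNLS.exists_abs_le_of_tendsto hα0 c00 h00
  obtain ⟨C₁, hC₁⟩ := FNLS.exists_abs_le_of_tendsto hα0 c01 h01
  set K := max (max C₀ C₁) 0 with hK
  have hK0 : 0 ≤ K := le_max_right _ _
  have b00 : ∀ x, |FNLS.kernel s a b 0 0 x| ≤ K * FNLS.weight (2 * s + 1) x := fun x =>
    (hC₀ x).trans (mul_le_mul_of_nonneg_right ((le_max_left _ _).trans (le_max_left _ _))
      (FNLS.weight_pos _ _).le)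
  have b01 : ∀ x, |FNLS.kernel s a b 0 1 x| ≤ K * FNLS.weight (2 * s + 1) x := fun x =>
    (hC₁ x).trans (mul_le_mul_of_nonneg_right ((le_max_right _ _).trans (le_max_left _ _))
      (FNLS.weight_pos _ _).le)
  have b10 : ∀ x, |FNLS.kernel s a b 1 0 x| ≤ K * FNLS.weight (2 * s + 1) x := fun x => by
    rw [FNLS.kernel_one_zero, abs_neg]; exact b01 x
  have b11 : ∀ x, |FNLS.kernel s a b 1 1 x| ≤ K * FNLS.weight (2 * s + 1) x := fun x => by
    rw [FNLS.kernel_one_one]; exact b00 x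
  set G₁ : ℝ → ℝ := fun y => FNLS.g₁ σ (v y) (w y) with hG₁
  set G₂ : ℝ → ℝ := fun y => FNLS.g₂ σ (v y) (w y) with hG₂
  have hpow : AEMeasurable (fun y => (v y ^ 2 + w y ^ 2) ^ σ) :=
    ((hv.1.aemeasurable.pow_const 2).add (hw.1.aemeasurable.pow_const 2)).pow_const σ
  have m₁ : AEStronglyMeasurable G₁ := (hpow.mul hv.1.aemeasurable).aestronglyMeasurable
  have m₂ : AEStronglyMeasurable G₂ := (hpow.mul hw.1.aemeasurable).aestronglyMeasurable
  obtain ⟨N₁, hN₁, hvN⟩ := FNLS.exists_ae_abs_le hv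
  obtain ⟨N₂, hN₂, hwN⟩ := FNLS.exists_ae_abs_le hw
  have hu : ∀ᵐ x, |v x| + |w x| ≤ N₁ + N₂ := by
    filter_upwards [hvN, hwN] with x h1 h2 using add_le_add h1 h2
  have hH : ∀ᵐ x, |G₁ x| + |G₂ x| ≤ (N₁ + N₂) ^ (2 * σ + 1) := by
    filter_upwards [hu] with x hx
    refine (FNLS.abs_g₁_add_abs_g₂_le hσ).trans ?_
    gcongr
  -- Vanishing at infinity enters here: the ratio of `|G₁| + |G₂|` to `|v| + |w|` is `(v² + w²)^σ`,
  -- which tends to `0`.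
  have hsmall : ∀ ε > 0, ∃ R, ∀ᵐ y, R < |y| → |G₁ y| + |G₂ y| ≤ ε * (|v y| + |w y|) := by
    intro ε hε
    have ht : Tendsto (fun y => (v y ^ 2 + w y ^ 2) ^ σ) FNLS.essInfty (𝓝 0) := by
      have := ((hv0.pow 2).add (hw0.pow 2)).rpow_const (p := σ) (Or.inr hσ.le)
      simpa [Real.zero_rpow hσ.ne'] using this
    obtain ⟨R, hR⟩ := FNLS.eventually_essInfty (ht.eventually (gt_mem_nhds hε))
    refine ⟨R, ?_⟩
    filter_upwards [hR] with y hy hyR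
    rw [hG₁, hG₂, FNLS.abs_g₁_add_abs_g₂]
    have := (hy hyR).le
    gcongr
  have hconv : ∀ᵐ x, |v x| + |w x| ≤
      2 * K * ∫ y, FNLS.weight (2 * s + 1) (x - y) * (|G₁ y| + |G₂ y|) := by
    filter_upwards [hsol] with x hx
    have hcw := FNLS.continuous_weight (2 * s + 1)
    have hi : Integrable fun y => FNLS.weight (2 * s + 1) (x - y) * (|G₁ y| + |G₂ y|) := by
      refine Integrable.mono' ((FNLS.integrable_weight_sub hα x).mul_const
        ((N₁ + N₂) ^ (2 * σ + 1))) ((hcw.comp (by fun_prop : Continuous fun y =>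
        x - y)).aestronglyMeasurable.mul (m₁.norm.add m₂.norm)) ?_
      filter_upwards [hH] with y hy
      have hwp := (FNLS.weight_pos (2 * s + 1) (x - y)).le
      rw [Real.norm_eq_abs, abs_of_nonneg (by positivity)]
      gcongr
    have e1 := FNLS.abs_integral_le_of_abs_le_weight b00 b01 hi
    have e2 := FNLS.abs_integral_le_of_abs_le_weight b10 b11 hi
    rw [← hx.1] at e1
    rw [← hx.2] at e2
    linarith
  obtain ⟨B, hB0, hB⟩ := FNLS.exists_le_weight_of_le_convolution hα (by positivity : 0 ≤ 2 * K)
    (fun x => by positivity) (fun x => by positivity) hu hH hsmall hconv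
  -- Since `σ > 0`, the nonlinearity decays at a rate strictly larger than that of the kernel, as
  -- the tail lemma requires; integrability of `G₁` and `G₂` follows as well.
  set γ := (2 * s + 1) * (2 * σ + 1) with hγdef
  have hγ : 2 * s + 1 < γ := by rw [hγdef]; nlinarith
  have hdec : ∀ᵐ y, |G₁ y| + |G₂ y| ≤ B ^ (2 * σ + 1) * FNLS.weight γ y := by
    filter_upwards [hB] with y hy
    refine (FNLS.abs_g₁_add_abs_g₂_le hσ).trans ?_
    calc (|v y| + |w y|) ^ (2 * σ + 1) ≤ (B * FNLS.weight (2 * s + 1) y) ^ (2 * σ + 1) := by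
          gcongr
      _ = B ^ (2 * σ + 1) * FNLS.weight γ y := by
          rw [Real.mul_rpow hB0 (FNLS.weight_pos _ _).le, FNLS.weight, FNLS.weight,
            ← Real.rpow_mul (by positivity), hγdef, neg_mul]
  have d₁ : ∀ᵐ y, |G₁ y| ≤ B ^ (2 * σ + 1) * FNLS.weight γ y := by
    filter_upwards [hdec] with y hy
    linarith [abs_nonneg (G₂ y)]
  have d₂ : ∀ᵐ y, |G₂ y| ≤ B ^ (2 * σ + 1) * FNLS.weight γ y := by
    filter_upwards [hdec] with y hy
    linarith [abs_nonneg (G₁ y)]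
  have i₁ : Integrable G₁ :=
    ((FNLS.integrable_weight (hα.trans hγ)).const_mul _).mono' m₁ d₁
  have i₂ : Integrable G₂ :=
    ((FNLS.integrable_weight (hα.trans hγ)).const_mul _).mono' m₂ d₂
  have tv := FNLS.tendsto_rpow_mul_convolution_add hα hγ c00 c01 b00 b01 h00 h01 i₁ i₂ d₁ d₂
  -- In the second row the diagonal kernel acts on `G₂`, so the two summands are exchanged; `eqw`
  -- restores the order in the system.
  have tw := FNLS.tendsto_rpow_mul_convolution_add hα hγ c11 c10 b11 b10 h11 h10 i₂ i₁ d₂ d₁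
  have eqw : ∀ x, FNLS.SolvesAt s a b σ v w x →
      w x = ∫ y, (FNLS.kernel s a b 1 1 (x - y) * G₂ y + FNLS.kernel s a b 1 0 (x - y) * G₁ y) :=
    fun x hx => hx.2.trans (by simp only [add_comm, hG₁, hG₂])
  have hle : FNLS.essInfty ≤ cocompact ℝ := inf_le_left
  have hae : ∀ᶠ x in FNLS.essInfty, FNLS.SolvesAt s a b σ v w x :=
    (inf_le_right : FNLS.essInfty ≤ ae volume) hsol
  refine ⟨i₁, i₂, (tv.mono_left hle).congr' ?_, (tw.mono_left hle).congr' ?_, fun hall =>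
    ⟨tv.congr fun x => ?_, tw.congr fun x => ?_⟩, B, ?_⟩
  · filter_upwards [hae] with x hx
    rw [hx.1]
  · filter_upwards [hae] with x hx
    rw [eqw x hx]
  · rw [(hall x).1]
  · rw [eqw x (hall x)]
  · filter_upwards [hB] with x hx
    have hsqrt : Real.sqrt (v x ^ 2 + w x ^ 2) ≤ |v x| + |w x| := by
      refine Real.sqrt_le_iff.2 ⟨by positivity, ?_⟩
      nlinarith [abs_nonneg (v x), abs_nonneg (w x), sq_abs (v x), sq_abs (w x)]
    calc |x| ^ (2 * s + 1) * Real.sqrt (v x ^ 2 + w x ^ 2)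
        ≤ (1 + |x|) ^ (2 * s + 1) * (B * FNLS.weight (2 * s + 1) x) := by
          gcongr
          · linarith
          · exact hsqrt.trans hx
      _ = B := by
          rw [FNLS.weight, Real.rpow_neg (by positivity)]
          field_simp
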